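/- Let $d,m\in\mathbb N$ with $m\ge 1$, let $D\subset\mathbb R^d$ be a bounded open set (in particular, $D$ may be a bounded domain of polyhedral type), let $0<T<\infty$ and put $D_T=(0,T]\times D$. Let $H^m(D)$ be the Sobolev space of real-valued functions in $L_2(D)$ with weak derivatives up to order $m$ in $L_2(D)$, normed by $\|u|H^m(D)\|=\big(\sum_{|\alpha|\le m}\|D^\alpha u|L_2(D)\|^2\big)^{1/2}$, let $\mathring H^m(D)$ be the closure of $C_c^\infty(D)$ in $H^m(D)$, and let $H^{-m}(D)$ be its dual space, where $\mathring H^m(D)$ is regarded as a subspace of $H^{-m}(D)$ via $\langle u,v\rangle=\int_D uv\,\mathrm dx$. Put $$H^{m,1*}(D_T)=L_2([0,T],\mathring H^m(D))\cap H^1([0,T],H^{-m}(D)),\qquad \|u|H^{m,1*}(D_T)\|=\|u|L_2([0,T],\mathring H^m(D))\|+\|u|H^1([0,T],H^{-m}(D))\|,$$ where $\|u|H^1([0,T],X)\|^2=\|u|L_2([0,T],X)\|^2+\|\partial_t u|L_2([0,T],X)\|^2$ with the weak derivative $\partial_t u$. Let $a_{\alpha\beta}$, $|\alpha|,|\beta|\le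 m$, be bounded real-valued functions in $C^\infty(D_T)$ such that for some $c>0$ $$\sum_{|\alpha|=|\beta|=m}a_{\alpha\beta}(t,x)\xi^\alpha\xi^\beta\ge c|\xi|^{2m}\qquad\text{for all }(t,x)\in D_T,\ \xi\in\mathbb R^d,$$ and let $L(t,x,D_x)=\sum_{|\alpha|,|\beta|\le m}D_x^\alpha(a_{\alpha\beta}(t,x)D_x^\beta)$. Suppose that the bilinear form of $(-1)^mL$, $$B(t,u,v)=\sum_{|\alpha|,|\beta|\le m}(-1)^{m+|\alpha|}\int_D a_{\alpha\beta}(t,x)\,(D^\beta u)(D^\alpha v)\,\mathrm dx,$$ is coercive: there is $\mu>0$ with $B(t,u,u)\ge\mu\|u|H^m(D)\|^2$ for a.e. $t\in[0,T]$ and all $u\in\mathring H^m(D)$. For $f\in L_2([0,T],H^{-m}(D))$ consider the problem $$\partial_t u+(-1)^mL(t,x,D_x)u=f\ \text{ in }D_T,\qquad u|_{t=0}=0\ \text{ in } D,$$ with homogeneous Dirichlet boundary conditions of order $m$. A weak solution is a function $u\in H^{m,1*}(D_T)$ such that for a.e. $t\in[0,T]$ and all $v\in\mathring H^m(D)$ $$\langle\partial_t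 u(t),v\rangle+B(t,u(t),v)=\langle f(t),v\rangle,$$ and such that $u(0)=0$, where $u$ is identified with its continuous representative on $[0,T]$ with values in $H^{-m}(D)$. Then there is a constant $C$, independent of $f$ and $u$, such that for every $f\in L_2([0,T],H^{-m}(D))$ the problem has a unique weak solution $u\in H^{m,1*}(D_T)$, and $$\|u|H^{m,1*}(D_T)\|\le C\,\|f|L_2([0,T],H^{-m}(D))\|.$$ -/

import Mathlib

open MeasureTheory Set
open scoped ContDiff ENNReal

noncomputable section

namespace ParabolicSobolev

/-! ### Multi-indices and classical derivatives -/

/-- The space `ℝ^d` with the Euclidean norm. -/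
abbrev Space (d : ℕ) : Type := EuclideanSpace ℝ (Fin d)

/-- Multi-indices `α ∈ ℕ₀^d` with `|α| ≤ m` (every entry of such an `α` is at most `m`). -/
abbrev MultiIndex (d m : ℕ) : Type :=
  {α : Fin d → Fin (m + 1) // ∑ i, (α i : ℕ) ≤ m}

/-- The length `|α| = α₁ + ⋯ + α_d`. -/
def MultiIndex.length {d m : ℕ} (α : MultiIndex d m) : ℕ := ∑ i, (α.1 i : ℕ)

/-- The zero multi-index. -/
def MultiIndex.zero (d m : ℕ) : MultiIndex d m := ⟨fun _ => 0, by simp⟩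

/-- The monomial `ξ^α`. -/
def MultiIndex.monomial {d m : ℕ} (α : MultiIndex d m) (ξ : Space d) : ℝ :=
  ∏ i, ξ i ^ (α.1 i : ℕ)

/-- The classical partial derivative `∂φ/∂x_i`. -/
def partialDeriv {d : ℕ} (i : Fin d) (φ : Space d → ℝ) : Space d → ℝ :=
  fun x => fderiv ℝ φ x (EuclideanSpace.single i 1)

/-- The classical derivative `D^α φ = ∂₁^{α₁} ⋯ ∂_d^{α_d} φ`. -/
def multiDeriv {d m : ℕ} (α : MultiIndex d m) (φ : Space d → ℝ) : Space d → ℝ :=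
  (List.finRange d).foldr (fun i ψ => (partialDeriv i)^[(α.1 i : ℕ)] ψ) φ

/-- Test functions on `D`: smooth functions whose support is a compact subset of `D`. -/
def IsTestFunction {V : Type*} [NormedAddCommGroup V] [NormedSpace ℝ V]
    (D : Set V) (φ : V → ℝ) : Prop :=
  ContDiff ℝ ∞ φ ∧ HasCompactSupport φ ∧ tsupport φ ⊆ D

/-! ### The Sobolev spaces `H^m(D)`, `H^m_0(D)` and `H^{-m}(D)` -/

/-- `L_2(D)`. -/
abbrev L2 {d : ℕ} (D : Set (Space d)) : Type := Lp ℝ 2 (volume.restrict D)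

/-- `g` is the weak derivative `D^α u` on `D`. -/
def IsWeakDeriv {d m : ℕ} (D : Set (Space d)) (α : MultiIndex d m) (u g : L2 D) : Prop :=
  ∀ φ : Space d → ℝ, IsTestFunction D φ →
    ∫ x in D, u x * multiDeriv α φ x = (-1 : ℝ) ^ α.length * ∫ x in D, g x * φ x

lemma IsTestFunction.partialDeriv {d : ℕ} {D : Set (Space d)} {φ : Space d → ℝ}
    (h : IsTestFunction D φ) (i : Fin d) : IsTestFunction D (partialDeriv i φ) := by
  obtain ⟨h1, h2, h3⟩ := h
  have hs : tsupport (ParabolicSobolev.partialDeriv i φ) ⊆ tsupport φ :=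
    tsupport_fderiv_apply_subset ℝ _
  exact ⟨(h1.fderiv_right (m := ∞) (by simp)).clm_apply contDiff_const,
    h2.mono' (subset_tsupport _ |>.trans hs), hs.trans h3⟩

lemma IsTestFunction.multiDeriv {d m : ℕ} {D : Set (Space d)} {φ : Space d → ℝ}
    (h : IsTestFunction D φ) (α : MultiIndex d m) : IsTestFunction D (multiDeriv α φ) := by
  have hit : ∀ (i : Fin d) (n : ℕ) (ψ : Space d → ℝ), IsTestFunction D ψ →
      IsTestFunction D ((ParabolicSobolev.partialDeriv i)^[n] ψ) := by
    intro i n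
    induction n with
    | zero => intro ψ hψ; exact hψ
    | succ k ih => intro ψ hψ; exact ih _ (hψ.partialDeriv i)
  unfold ParabolicSobolev.multiDeriv
  generalize List.finRange d = l
  induction l with
  | nil => exact h
  | cons i l ih => exact hit _ _ _ ih

lemma IsTestFunction.integrable_mul {d : ℕ} {D : Set (Space d)} {φ : Space d → ℝ}
    (h : IsTestFunction D φ) (u : L2 D) : Integrable (fun x => u x * φ x) (volume.restrict D) :=
  (Lp.memLp u).integrable_mul
    (h.1.continuous.memLp_of_hasCompactSupport h.2.1 : MemLp φ 2 (volume.restrict D))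

/-- The Sobolev space `H^m(D)`. A function `u ∈ H^m(D)` is represented by the family
`(D^α u)_{|α| ≤ m}` of its weak derivatives in `L_2(D)`, so that the norm is
`‖u | H^m(D)‖ = (∑_{|α| ≤ m} ‖D^α u | L_2(D)‖²)^{1/2}`. -/
def Hm {d : ℕ} (m : ℕ) (D : Set (Space d)) :
    Submodule ℝ (PiLp 2 (fun _ : MultiIndex d m => L2 D)) where
  carrier := {u | ∀ α, IsWeakDeriv D α (u (MultiIndex.zero d m)) (u α)}
  zero_mem' := by
    intro α φ hφ
    have h0 : ((0 : L2 D) : Space d → ℝ) =ᵐ[volume.restrict D] 0 := Lp.coeFn_zero _ _ _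
    have key : ∀ ψ : Space d → ℝ, ∫ x in D, (0 : L2 D) x * ψ x = 0 := by
      intro ψ
      refine integral_eq_zero_of_ae ?_
      filter_upwards [h0] with x hx
      rw [hx]
      simp
    simp only [PiLp.zero_apply, key, mul_zero]
  add_mem' := by
    intro u v hu hv α φ hφ
    have key : ∀ (a b : L2 D) (ψ : Space d → ℝ), IsTestFunction D ψ →
        ∫ x in D, (a + b) x * ψ x = (∫ x in D, a x * ψ x) + ∫ x in D, b x * ψ x := by
      intro a b ψ hψ
      rw [← integral_add (hψ.integrable_mul a) (hψ.integrable_mul b)]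
      refine integral_congr_ae ?_
      filter_upwards [Lp.coeFn_add a b] with x hx
      rw [hx, Pi.add_apply, add_mul]
    simp only [PiLp.add_apply]
    rw [key _ _ _ (hφ.multiDeriv α), key _ _ _ hφ, hu α φ hφ, hv α φ hφ, mul_add]
  smul_mem' := by
    intro c u hu α φ hφ
    have key : ∀ (a : L2 D) (ψ : Space d → ℝ),
        ∫ x in D, (c • a) x * ψ x = c * ∫ x in D, a x * ψ x := by
      intro a ψ
      rw [← integral_const_mul]
      refine integral_congr_ae ?_
      filter_upwards [Lp.coeFn_smul c a] with x hx
      simp [hx, mul_assoc]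
    simp only [PiLp.smul_apply]
    rw [key, key, hu α φ hφ]
    ring

/-- The elements of `H^m(D)` that are (represented by) test functions on `D`. -/
def testFunctions {d : ℕ} (m : ℕ) (D : Set (Space d)) : Submodule ℝ (Hm m D) where
  carrier := {u | ∃ φ : Space d → ℝ, IsTestFunction D φ ∧
    u.1 (MultiIndex.zero d m) =ᵐ[volume.restrict D] φ}
  zero_mem' := by
    refine ⟨fun _ => 0, ⟨contDiff_const, HasCompactSupport.zero, by simp [tsupport]⟩, ?_⟩
    exact Lp.coeFn_zero _ _ _
  add_mem' := by
    rintro u v ⟨φ, ⟨h1, h2, h3⟩, hu⟩ ⟨ψ, ⟨k1, k2, k3⟩, hv⟩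
    refine ⟨φ + ψ, ⟨h1.add k1, h2.add k2, (tsupport_add φ ψ).trans (union_subset h3 k3)⟩, ?_⟩
    exact (Lp.coeFn_add _ _).trans (hu.add hv)
  smul_mem' := by
    rintro c u ⟨φ, ⟨h1, h2, h3⟩, hu⟩
    refine ⟨c • φ, ⟨contDiff_const.smul h1, h2.smul_left (f := fun _ => c),
      (closure_mono (Function.support_const_smul_subset c φ)).trans h3⟩, ?_⟩
    exact (Lp.coeFn_smul _ _).trans (hu.const_smul c)

/-- `H^m_0(D)`: the closure of the test functions in `H^m(D)`, with the norm of `H^m(D)`. -/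
def H0 {d : ℕ} (m : ℕ) (D : Set (Space d)) : Type := ↥(testFunctions m D).topologicalClosure

instance {d : ℕ} (m : ℕ) (D : Set (Space d)) : NormedAddCommGroup (H0 m D) :=
  inferInstanceAs (NormedAddCommGroup ↥(testFunctions m D).topologicalClosure)

instance {d : ℕ} (m : ℕ) (D : Set (Space d)) : InnerProductSpace ℝ (H0 m D) :=
  inferInstanceAs (InnerProductSpace ℝ ↥(testFunctions m D).topologicalClosure)

/-- The inclusion `H^m_0(D) ⊆ H^m(D)`. -/
def H0.incl {d : ℕ} (m : ℕ) (D : Set (Space d)) : H0 m D →L[ℝ] Hm m D :=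
  (testFunctions m D).topologicalClosure.subtypeL

/-- The weak derivative `D^α u ∈ L_2(D)` of `u ∈ H^m_0(D)`. -/
def weakD {d m : ℕ} {D : Set (Space d)} (α : MultiIndex d m) : H0 m D →L[ℝ] L2 D :=
  (PiLp.proj 2 (fun _ : MultiIndex d m => L2 D) α : _ →L[ℝ] L2 D) ∘L
    (Hm m D).subtypeL ∘L H0.incl m D

/-- `H^{-m}(D)`: the dual space of `H^m_0(D)`, with the dual norm. -/
abbrev Hneg {d : ℕ} (m : ℕ) (D : Set (Space d)) : Type := StrongDual ℝ (H0 m D)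

/-- The map `V → V'` induced by a map `P : V → H` into a Hilbert space: `⟨u, v⟩ = (P u, P v)_H`. -/
def toDualVia {V H : Type*} [NormedAddCommGroup V] [NormedSpace ℝ V] [NormedAddCommGroup H]
    [InnerProductSpace ℝ H] (P : V →L[ℝ] H) : V →L[ℝ] StrongDual ℝ V :=
  ((ContinuousLinearMap.compL ℝ V H ℝ).flip P) ∘L (innerSL ℝ : H →L[ℝ] H →L[ℝ] ℝ) ∘L P

lemma toDualVia_apply {V H : Type*} [NormedAddCommGroup V] [NormedSpace ℝ V]
    [NormedAddCommGroup H] [InnerProductSpace ℝ H] (P : V →L[ℝ] H) (u v : V) :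
    toDualVia P u v = inner ℝ (P u) (P v) := rfl

/-- The embedding `H^m_0(D) ↪ H^{-m}(D)` given by `⟨u, v⟩ = ∫_D u v dx`. -/
def embed {d : ℕ} (m : ℕ) (D : Set (Space d)) : H0 m D →L[ℝ] Hneg m D :=
  toDualVia (weakD (MultiIndex.zero d m))

/-! ### Bochner spaces on `[0,T]` -/

/-- Lebesgue measure on `[0,T]`. -/
abbrev timeMeasure (T : ℝ) : Measure ℝ := volume.restrict (Icc 0 T)

/-- `L_2([0,T], X)`. -/
abbrev TimeL2 (T : ℝ) (X : Type) [NormedAddCommGroup X] : Type := Lp X 2 (timeMeasure T)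

/-- `w'` is the weak time derivative of `w` on `(0,T)`. -/
def IsWeakTimeDeriv {T : ℝ} {X : Type} [NormedAddCommGroup X] [NormedSpace ℝ X]
    (w w' : TimeL2 T X) : Prop :=
  ∀ φ : ℝ → ℝ, IsTestFunction (Ioo 0 T) φ →
    ∫ t, deriv φ t • w t ∂timeMeasure T = - ∫ t, φ t • w' t ∂timeMeasure T

lemma integrable_smul_timeL2 {T : ℝ} {X : Type} [NormedAddCommGroup X] [NormedSpace ℝ X]
    {φ : ℝ → ℝ} (h1 : Continuous φ) (h2 : HasCompactSupport φ) (w : TimeL2 T X) :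
    Integrable (fun t => φ t • w t) (timeMeasure T) :=
  memLp_one_iff_integrable.1
    ((Lp.memLp w).smul (h1.memLp_of_hasCompactSupport h2 : MemLp φ 2 (timeMeasure T)))

/-- `H^1([0,T], X)`. A function `w` is represented by the pair `(w, ∂_t w)`, so that the norm is
`(‖w | L_2([0,T], X)‖² + ‖∂_t w | L_2([0,T], X)‖²)^{1/2}`. -/
def TimeH1 (T : ℝ) (X : Type) [NormedAddCommGroup X] [NormedSpace ℝ X] :
    Submodule ℝ (WithLp 2 (TimeL2 T X × TimeL2 T X)) where
  carrier := {w | IsWeakTimeDeriv w.fst w.snd}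
  zero_mem' := by
    intro φ hφ
    have h0 : ((0 : TimeL2 T X) : ℝ → X) =ᵐ[timeMeasure T] 0 := Lp.coeFn_zero _ _ _
    have key : ∀ ψ : ℝ → ℝ, ∫ t, ψ t • (0 : TimeL2 T X) t ∂timeMeasure T = 0 := by
      intro ψ
      refine integral_eq_zero_of_ae ?_
      filter_upwards [h0] with x hx
      rw [hx]
      simp
    simp only [WithLp.zero_fst, WithLp.zero_snd, key, neg_zero]
  add_mem' := by
    intro u v hu hv φ hφ
    have key : ∀ (a b : TimeL2 T X) (ψ : ℝ → ℝ), Continuous ψ → HasCompactSupport ψ →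
        ∫ t, ψ t • (a + b) t ∂timeMeasure T =
          (∫ t, ψ t • a t ∂timeMeasure T) + ∫ t, ψ t • b t ∂timeMeasure T := by
      intro a b ψ h1 h2
      rw [← integral_add (integrable_smul_timeL2 h1 h2 a) (integrable_smul_timeL2 h1 h2 b)]
      refine integral_congr_ae ?_
      filter_upwards [Lp.coeFn_add a b] with x hx
      rw [hx, Pi.add_apply, smul_add]
    simp only [WithLp.add_fst, WithLp.add_snd]
    rw [key _ _ _ (hφ.1.continuous_deriv (by simp)) hφ.2.1.deriv,
      key _ _ _ hφ.1.continuous hφ.2.1, hu φ hφ, hv φ hφ, neg_add]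
  smul_mem' := by
    intro c u hu φ hφ
    have key : ∀ (a : TimeL2 T X) (ψ : ℝ → ℝ),
        ∫ t, ψ t • (c • a) t ∂timeMeasure T = c • ∫ t, ψ t • a t ∂timeMeasure T := by
      intro a ψ
      rw [← integral_smul]
      refine integral_congr_ae ?_
      filter_upwards [Lp.coeFn_smul c a] with x hx
      simp [hx, smul_comm c]
    simp only [WithLp.smul_fst, WithLp.smul_snd]
    rw [key, key, hu φ hφ, smul_neg]

/-- The intersection `L_2([0,T], V) ∩ H^1([0,T], X)`, where `V` is regarded as a subspace of `X`
through `ι`. An element of the intersection is represented by the pair of its versions in the two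
spaces, so that the norm is `‖u | L_2([0,T], V)‖ + ‖u | H^1([0,T], X)‖`. -/
def TimeInter (T : ℝ) {V X : Type} [NormedAddCommGroup V] [NormedSpace ℝ V]
    [NormedAddCommGroup X] [NormedSpace ℝ X] (ι : V →L[ℝ] X) :
    Submodule ℝ (WithLp 1 (TimeL2 T V × TimeH1 T X)) where
  carrier := {u | ι.compLp u.fst = u.snd.1.fst}
  zero_mem' := by
    change ι.compLpL 2 (timeMeasure T) 0 = 0
    exact map_zero _
  add_mem' := by
    intro u v hu hv
    change ι.compLpL 2 (timeMeasure T) (u.fst + v.fst) = u.snd.1.fst + v.snd.1.fst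
    rw [map_add]
    exact congrArg₂ _ hu hv
  smul_mem' := by
    intro c u hu
    change ι.compLpL 2 (timeMeasure T) (c • u.fst) = c • u.snd.1.fst
    rw [map_smul]
    exact congrArg _ hu

/-- The space `H^{m,1*}(D_T) = L_2([0,T], H^m_0(D)) ∩ H^1([0,T], H^{-m}(D))`. -/
abbrev ParabolicSpace {d : ℕ} (m : ℕ) (D : Set (Space d)) (T : ℝ) :
    Submodule ℝ (WithLp 1 (TimeL2 T (H0 m D) × TimeH1 T (Hneg m D))) :=
  TimeInter T (embed m D)

/-- `u` as a function on `[0,T]` with values in `H^m_0(D)` (an element of `L_2`). -/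
def ParabolicSpace.val {d m : ℕ} {D : Set (Space d)} {T : ℝ} (u : ParabolicSpace m D T) :
    TimeL2 T (H0 m D) := u.1.fst

/-- The weak time derivative `∂_t u ∈ L_2([0,T], H^{-m}(D))`. -/
def ParabolicSpace.timeDeriv {d m : ℕ} {D : Set (Space d)} {T : ℝ} (u : ParabolicSpace m D T) :
    TimeL2 T (Hneg m D) := u.1.snd.1.snd

/-- The initial condition `u(0) = 0`: the continuous representative of `u` on `[0,T]` (with values
in `H^{-m}(D)`) vanishes at `t = 0`. -/
def ParabolicSpace.VanishesAtZero {d m : ℕ} {D : Set (Space d)} {T : ℝ}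
    (u : ParabolicSpace m D T) : Prop :=
  ∃ w : ℝ → Hneg m D, ContinuousOn w (Icc 0 T) ∧
    (∀ᵐ t ∂timeMeasure T, w t = embed m D (ParabolicSpace.val u t)) ∧ w 0 = 0

/-! ### The parabolic problem -/

/-- Coefficients `a_{αβ}(t,x)`, `|α|, |β| ≤ m`, of the differential operator
`L(t,x,D_x) = ∑_{|α|,|β| ≤ m} D^α (a_{αβ}(t,x) D^β)`. -/
abbrev Coefficients (d m : ℕ) : Type :=
  MultiIndex d m → MultiIndex d m → ℝ → Space d → ℝ

/-- The coefficients are smooth and bounded on `D_T = (0,T] × D`, and `L` is uniformly elliptic. -/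
structure IsAdmissible {d m : ℕ} (D : Set (Space d)) (T : ℝ) (a : Coefficients d m) : Prop where
  smooth : ∀ α β, ContDiffOn ℝ ∞ (fun p : ℝ × Space d => a α β p.1 p.2) (Ioc 0 T ×ˢ D)
  bounded : ∃ M : ℝ, ∀ α β, ∀ t ∈ Ioc 0 T, ∀ x ∈ D, |a α β t x| ≤ M
  elliptic : ∃ c : ℝ, 0 < c ∧ ∀ t ∈ Ioc 0 T, ∀ x ∈ D, ∀ ξ : Space d,
    c * ‖ξ‖ ^ (2 * m) ≤
      ∑ α : MultiIndex d m with α.length = m, ∑ β : MultiIndex d m with β.length = m,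
        a α β t x * α.monomial ξ * β.monomial ξ

/-- The bilinear form `B(t,u,v)` on `H^m_0(D)` of the operator `(-1)^m L(t,x,D_x)`: integrating
`(-1)^m ∫_D D^α (a_{αβ} D^β u) v dx` by parts `|α|` times gives the factor `(-1)^{m+|α|}`, which is
`1` for the terms of the main part. -/
def bilinearForm {d m : ℕ} {D : Set (Space d)} (a : Coefficients d m) (t : ℝ) (u v : H0 m D) : ℝ :=
  ∑ α : MultiIndex d m, ∑ β : MultiIndex d m,
    (-1 : ℝ) ^ (m + α.length) * ∫ x in D, a α β t x * weakD β u x * weakD α v x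

/-- Coercivity: `B(t,u,u) ≥ μ ‖u | H^m(D)‖²` for a.e. `t ∈ [0,T]` and all `u ∈ H^m_0(D)`. -/
def IsCoercive {d m : ℕ} (D : Set (Space d)) (T : ℝ) (a : Coefficients d m) : Prop :=
  ∃ μ : ℝ, 0 < μ ∧ ∀ᵐ t ∂timeMeasure T, ∀ u : H0 m D, μ * ‖u‖ ^ 2 ≤ bilinearForm a t u u

/-- `u ∈ H^{m,1*}(D_T)` is a weak solution of `∂_t u + (-1)^m L u = f` in `D_T` with homogeneous
Dirichlet boundary conditions (contained in `u(t) ∈ H^m_0(D)`) and `u(0) = 0`. -/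
def IsWeakSolution {d m : ℕ} {D : Set (Space d)} {T : ℝ} (a : Coefficients d m)
    (f : TimeL2 T (Hneg m D)) (u : ParabolicSpace m D T) : Prop :=
  (∀ᵐ t ∂timeMeasure T, ∀ v : H0 m D,
    ParabolicSpace.timeDeriv u t v + bilinearForm a t (ParabolicSpace.val u t) v = f t v) ∧
  ParabolicSpace.VanishesAtZero u

end ParabolicSobolev

end

/-! Write `V` for `H0 m D`, `P : V → L2 D` for the inclusion and `X` for L₂([0,T], V). The Riesz
isomorphism identifies `V'` with `V` and turns the embedding `V → V'` into `J = P* P`. By du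
Bois-Reymond, an element of the solution space vanishes at time 0 exactly when its image in
L₂([0,T], V') is the primitive of its time derivative. With `K` the Volterra operator and `A` the
pointwise action of the form operators, the whole problem becomes one equation in `X`: `J u + K A u
= K f`, where `f` now stands for its Riesz representative.

Integration by parts gives 2⟨g, K g⟩ = ‖∫ g‖², so `K` is monotone. As `K` commutes with operators
acting pointwise in time, ⟨J x, K x⟩ = ⟨P x, K P x⟩ ≥ 0. Coercivity of the form makes `A` coercive
on `X`.

Existence (`exists_solution`): for `S = J + A* K*`, testing `S x` with `K* x` gives c‖K* x‖ ≤ ‖S x‖,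
and Lions' projection theorem applies. Uniqueness (`solution_unique`): the difference `w` of two
solutions satisfies `J w = K(-A w)`. Regularizing `K` by `K + ε` shows ⟨-A w, w⟩ ≥ 0
(`inner_nonneg_of_eq_apply`), against coercivity unless `w = 0`. No Galerkin approximation and no
trace in L₂(D) is needed. -/

noncomputable section

namespace ParabolicSobolev

/-! ### Primitives with respect to a finite measure without atoms -/

section Volterra

variable {E F G : Type*} [NormedAddCommGroup E] [NormedSpace ℝ E] [NormedAddCommGroup F]
  [NormedSpace ℝ F] [NormedAddCommGroup G] [NormedSpace ℝ G]

lemma continuous_integral_Iic {μ : Measure ℝ} [NullSingletonClass μ] {f : ℝ → E} (hf : Integrable f μ) :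
    Continuous fun t => ∫ s in Iic t, f s ∂μ := by
  have h : (fun t => ∫ s in Iic t, f s ∂μ) =
      fun t => (∫ s in (0 : ℝ)..t, f s ∂μ) + ∫ s in Iic 0, f s ∂μ := by
    funext t
    rw [← intervalIntegral.integral_Iic_sub_Iic hf.integrableOn hf.integrableOn]
    abel
  rw [h]
  exact (hf.continuous_primitive 0).add continuous_const

variable [CompleteSpace E] [CompleteSpace F] [CompleteSpace G]

/-- Fubini on the triangle s ≤ t: both sides are iterated integrals of the same indicator function.
-/
lemma integral_bilin_Iic_swap {μ : Measure ℝ} [IsFiniteMeasure μ] (L : E →L[ℝ] F →L[ℝ] G)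
    {f : ℝ → E} {g : ℝ → F} (hf : Integrable f μ) (hg : Integrable g μ) :
    ∫ t, L (f t) (∫ s in Iic t, g s ∂μ) ∂μ = ∫ t, L (∫ s in Ici t, f s ∂μ) (g t) ∂μ := by
  have h1 : ∀ t, L (f t) (∫ s in Iic t, g s ∂μ) =
      ∫ s, {p : ℝ × ℝ | p.2 ≤ p.1}.indicator (fun p => L (f p.1) (g p.2)) (t, s) ∂μ := by
    intro t
    rw [← ContinuousLinearMap.integral_comp_comm _ hg.integrableOn,
      ← integral_indicator measurableSet_Iic]
    rfl
  have h2 : ∀ t, L (∫ s in Ici t, f s ∂μ) (g t) =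
      ∫ s, {p : ℝ × ℝ | p.2 ≤ p.1}.indicator (fun p => L (f p.1) (g p.2)) (s, t) ∂μ := by
    intro t
    change L.flip (g t) _ = _
    rw [← ContinuousLinearMap.integral_comp_comm _ hf.integrableOn,
      ← integral_indicator measurableSet_Ici]
    rfl
  simp_rw [h1, h2]
  refine integral_integral_swap (f := fun t s =>
    {p : ℝ × ℝ | p.2 ≤ p.1}.indicator (fun p => L (f p.1) (g p.2)) (t, s)) ?_
  refine Integrable.indicator ?_ (measurableSet_le measurable_snd measurable_fst)
  exact Integrable.op_fst_snd (L.isBoundedBilinearMap.continuous)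
    ⟨‖L‖, fun x y => L.le_opNorm₂ x y⟩ hf hg

/-- Integration by parts for primitives. -/
lemma integral_bilin_primitive {μ : Measure ℝ} [IsFiniteMeasure μ] [NullSingletonClass μ]
    (L : E →L[ℝ] F →L[ℝ] G) {f : ℝ → E} {g : ℝ → F} (hf : Integrable f μ) (hg : Integrable g μ) :
    ∫ t, L (∫ s in Iic t, f s ∂μ) (g t) ∂μ + ∫ t, L (f t) (∫ s in Iic t, g s ∂μ) ∂μ =
      L (∫ t, f t ∂μ) (∫ t, g t ∂μ) := by
  have hmul : ∀ {h : ℝ → E}, Continuous h → (∃ C, ∀ t, ‖h t‖ ≤ C) →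
      Integrable (fun t => L (h t) (g t)) μ := by
    rintro h hc ⟨C, hC⟩
    refine (hg.norm.const_mul (‖L‖ * C)).mono'
      (L.aestronglyMeasurable_comp₂ hc.aestronglyMeasurable hg.1) (.of_forall fun t => ?_)
    refine (L.le_opNorm₂ _ _).trans ?_
    gcongr
    exact hC t
  have hb : ∀ (h : ℝ → E) (s : Set ℝ), Integrable h μ → ‖∫ t in s, h t ∂μ‖ ≤ ∫ t, ‖h t‖ ∂μ :=
    fun h s hh => (norm_integral_le_integral_norm _).trans
      (setIntegral_le_integral hh.norm (.of_forall fun _ => norm_nonneg _))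
  -- Without atoms `Ici t` and `Ioi t` carry the same integral. After the Fubini swap the pieces
  -- over `Iic t` and `Ici t` therefore add up to the full integral of `f`.
  have hsplit : ∀ t, ∫ s in Ici t, f s ∂μ = ∫ s, f s ∂μ - ∫ s in Iic t, f s ∂μ := by
    intro t
    rw [integral_Ici_eq_integral_Ioi, eq_sub_iff_add_eq', intervalIntegral.integral_Iic_add_Ioi
      hf.integrableOn hf.integrableOn]
  have hc := continuous_integral_Iic hf
  rw [integral_bilin_Iic_swap L hf hg, ← integral_add (hmul hc ⟨_, fun t => hb f _ hf⟩)
    (hmul (by simp_rw [hsplit]; exact continuous_const.sub hc) ⟨_, fun t => hb f _ hf⟩)]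
  rw [← ContinuousLinearMap.integral_comp_comm _ hg]
  refine integral_congr_ae (.of_forall fun t => ?_)
  simp [hsplit]

omit [CompleteSpace E] in
lemma norm_integral_Iic_le {μ : Measure ℝ} [IsFiniteMeasure μ] (g : Lp E 2 μ) (t : ℝ) :
    ‖∫ s in Iic t, g s ∂μ‖ ≤ (μ univ ^ (1 / 2 : ℝ)).toReal * ‖g‖ := by
  have hg : Integrable g μ := (Lp.memLp g).integrable one_le_two
  refine (norm_integral_le_integral_norm _).trans
    ((setIntegral_le_integral hg.norm (.of_forall fun _ => norm_nonneg _)).trans ?_)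
  rw [integral_norm_eq_lintegral_enorm hg.1, ← eLpNorm_one_eq_lintegral_enorm, Lp.norm_def,
    mul_comm, ← ENNReal.toReal_mul]
  refine ENNReal.toReal_mono (ENNReal.mul_ne_top (Lp.eLpNorm_ne_top g) (by finiteness)) ?_
  refine (eLpNorm_le_eLpNorm_mul_rpow_measure_univ one_le_two hg.1).trans (le_of_eq ?_)
  norm_num

omit [CompleteSpace E] in
lemma memLp_integral_Iic {μ : Measure ℝ} [IsFiniteMeasure μ] [NullSingletonClass μ]
    (g : Lp E 2 μ) : MemLp (fun t => ∫ s in Iic t, g s ∂μ) 2 μ :=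
  MemLp.of_bound (continuous_integral_Iic
    ((Lp.memLp g).integrable one_le_two)).aestronglyMeasurable _
    (.of_forall (norm_integral_Iic_le g))

/-- The Volterra operator `(K g)(t) = ∫_{s ≤ t} g(s) dμ(s)` on `L_2(μ; E)`. -/
def volterra (μ : Measure ℝ) [IsFiniteMeasure μ] [NullSingletonClass μ] : Lp E 2 μ →L[ℝ] Lp E 2 μ :=
  have hint (g : Lp E 2 μ) : Integrable g μ := (Lp.memLp g).integrable one_le_two
  LinearMap.mkContinuous
    { toFun g := (memLp_integral_Iic g).toLp
      map_add' f g := by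
        rw [← MemLp.toLp_add]
        congr 1
        funext t
        rw [Pi.add_apply, ← integral_add (hint f).integrableOn (hint g).integrableOn]
        exact integral_congr_ae (ae_restrict_of_ae (Lp.coeFn_add f g))
      map_smul' c g := by
        rw [← MemLp.toLp_const_smul]
        congr 1
        funext t
        rw [Pi.smul_apply, RingHom.id_apply, ← integral_smul]
        exact integral_congr_ae (ae_restrict_of_ae (Lp.coeFn_smul c g)) }
    -- One factor μ(univ)^(1/2) comes from Hölder in the pointwise bound, the other from passing
    -- from a uniform bound to the L₂ norm.
    ((measureUnivNNReal μ : ℝ) ^ (2 : ℝ≥0∞).toReal⁻¹ * (μ univ ^ (1 / 2 : ℝ)).toReal) (by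
      intro g
      rw [mul_assoc]
      refine Lp.norm_le_of_ae_bound (by positivity) ?_
      filter_upwards [(memLp_integral_Iic g).coeFn_toLp] with t ht
      change ‖(memLp_integral_Iic g).toLp _ t‖ ≤ _
      rw [ht]
      exact norm_integral_Iic_le g t)

omit [CompleteSpace E] in
lemma volterra_ae {μ : Measure ℝ} [IsFiniteMeasure μ] [NullSingletonClass μ] (g : Lp E 2 μ) :
    volterra μ g =ᵐ[μ] fun t => ∫ s in Iic t, g s ∂μ :=
  (memLp_integral_Iic g).coeFn_toLp

lemma volterra_compLp {μ : Measure ℝ} [IsFiniteMeasure μ] [NullSingletonClass μ] (P : E →L[ℝ] F)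
    (g : Lp E 2 μ) : volterra μ (P.compLp g) = P.compLp (volterra μ g) := by
  refine Lp.ext ?_
  filter_upwards [volterra_ae (P.compLp g), P.coeFn_compLp (volterra μ g), volterra_ae g]
    with t h1 h2 h3
  rw [h1, h2, h3, ← P.integral_comp_comm ((Lp.memLp g).integrable one_le_two).integrableOn]
  exact integral_congr_ae (ae_restrict_of_ae (P.coeFn_compLp g))

/-- Integration by parts with the inner product as bilinear map yields 2⟨g, K g⟩ = ‖∫ g‖². This
replaces the energy identity for ½‖u(T)‖². -/
lemma inner_volterra_nonneg {H : Type*} [NormedAddCommGroup H] [InnerProductSpace ℝ H]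
    [CompleteSpace H] {μ : Measure ℝ} [IsFiniteMeasure μ] [NullSingletonClass μ] (g : Lp H 2 μ) :
    0 ≤ inner ℝ g (volterra μ g) := by
  have hg : Integrable g μ := (Lp.memLp g).integrable one_le_two
  have h := integral_bilin_primitive (innerSL ℝ : H →L[ℝ] H →L[ℝ] ℝ) hg hg
  have h1 : ∫ t, (innerSL ℝ : H →L[ℝ] H →L[ℝ] ℝ) (∫ s in Iic t, g s ∂μ) (g t) ∂μ =
      inner ℝ g (volterra μ g) := by
    rw [L2.inner_def]
    refine integral_congr_ae ?_
    filter_upwards [volterra_ae g] with t ht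
    rw [ht]
    exact real_inner_comm _ _
  have h2 : ∫ t, (innerSL ℝ : H →L[ℝ] H →L[ℝ] ℝ) (g t) (∫ s in Iic t, g s ∂μ) ∂μ =
      inner ℝ g (volterra μ g) := by
    rw [L2.inner_def]
    refine integral_congr_ae ?_
    filter_upwards [volterra_ae g] with t ht
    rw [ht]
    rfl
  rw [h1, h2] at h
  have h3 : (0 : ℝ) ≤ inner ℝ (∫ t, g t ∂μ) (∫ t, g t ∂μ) := real_inner_self_nonneg
  change _ = inner ℝ (∫ t, g t ∂μ) (∫ t, g t ∂μ) at h
  linarith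

end Volterra

/-! ### An operator equation in a Hilbert space -/

section Hilbert

variable {X : Type*} [NormedAddCommGroup X] [InnerProductSpace ℝ X] [CompleteSpace X]

/-- Lions' projection theorem. -/
lemma exists_inner_eq_of_norm_le (S : X →ₗ[ℝ] X) (l : X →ₗ[ℝ] ℝ) (C : ℝ) (hC : 0 ≤ C)
    (h : ∀ x, |l x| ≤ C * ‖S x‖) : ∃ u : X, ‖u‖ ≤ C ∧ ∀ x, inner ℝ u (S x) = l x := by
  -- The bound forces `l` to vanish on ker `S`, so `l` descends to a bounded functional on the range
  -- of `S`; Hahn–Banach and Riesz then produce `u`.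
  have hker : LinearMap.ker S.rangeRestrict ≤ LinearMap.ker l := by
    intro x hx
    have hx' : S x = 0 := by simpa using hx
    have := h x
    rw [hx', norm_zero, mul_zero] at this
    exact abs_nonpos_iff.1 this
  obtain ⟨l', hl'⟩ : ∃ l' : LinearMap.range S →ₗ[ℝ] ℝ, ∀ x, l' (S.rangeRestrict x) = l x := by
    obtain ⟨T, hT⟩ := S.rangeRestrict.exists_rightInverse_of_surjective S.range_rangeRestrict
    refine ⟨l ∘ₗ T, fun x => ?_⟩
    rw [LinearMap.comp_apply, ← sub_eq_zero, ← map_sub]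
    refine hker ?_
    rw [LinearMap.mem_ker, map_sub, sub_eq_zero]
    exact LinearMap.congr_fun hT (S.rangeRestrict x)
  have hb : ∀ y : LinearMap.range S, ‖l' y‖ ≤ C * ‖y‖ := by
    rintro ⟨_, x, rfl⟩
    have := hl' x
    change l' ⟨S x, _⟩ = l x at this
    rw [this]
    exact h x
  obtain ⟨k, hk, hn⟩ := exists_extension_norm_eq (LinearMap.range S) (l'.mkContinuous C hb)
  refine ⟨(InnerProductSpace.toDual ℝ X).symm k, ?_, fun x => ?_⟩
  · rw [LinearIsometryEquiv.norm_map, hn]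
    exact LinearMap.mkContinuous_norm_le _ hC _
  · rw [InnerProductSpace.toDual_symm_apply]
    exact (hk (S.rangeRestrict x)).trans (hl' x)

/-- Monotonicity of `K⁻¹ ι`. -/
lemma inner_nonneg_of_eq_apply {J K : X →L[ℝ] X} (hJK : ∀ x, J (K x) = K (J x))
    (hJ : ∀ x, 0 ≤ inner ℝ (J x) x) (hK : ∀ x, 0 ≤ inner ℝ x (K x))
    (hJK0 : ∀ x, 0 ≤ inner ℝ (J x) (K x)) (hK0 : ∀ x, K x = 0 → x = 0) {u g : X}
    (h : J u = K g) : 0 ≤ inner ℝ g u := by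
  -- `R ε` will be the resolvent (K + ε)⁻¹: monotonicity of `K` makes `K + ε` coercive with constant
  -- ε, so Lax–Milgram applies.
  have hpos : ∀ ε : ℝ, 0 < ε → ∃ R : X →L[ℝ] X, (∀ x, K (R x) + ε • R x = x) ∧
      ∀ x, R (K x + ε • x) = x := by
    intro ε hε
    set N : X →L[ℝ] X := K + ε • ContinuousLinearMap.id ℝ X with hN
    have hco : _root_.IsCoercive ((innerSL ℝ : X →L[ℝ] X →L[ℝ] ℝ) ∘L N) := by
      refine ⟨ε, hε, fun x => ?_⟩
      change ε * ‖x‖ * ‖x‖ ≤ inner ℝ (K x + ε • x) x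
      rw [inner_add_left, inner_smul_left, real_inner_self_eq_norm_sq, real_inner_comm,
        conj_trivial]
      nlinarith [hK x]
    have heq : ∀ x, hco.continuousLinearEquivOfBilin x = K x + ε • x := fun x =>
      ext_inner_right ℝ fun v => hco.continuousLinearEquivOfBilin_apply x v
    refine ⟨hco.continuousLinearEquivOfBilin.symm, fun x => ?_, fun x => ?_⟩
    · rw [← heq]
      exact hco.continuousLinearEquivOfBilin.apply_symm_apply x
    · rw [← heq]
      exact hco.continuousLinearEquivOfBilin.symm_apply_apply x
  choose! R hR1 hR2 using hpos
  -- `y ε` tends weakly to 0 as ε → 0: it stays bounded by `‖g‖`, `K (y ε)` is of order ε, and the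
  -- range of `K*` is dense.
  set y : ℝ → X := fun ε => ε • R ε g with hy
  have hRn : ∀ ε > 0, ‖y ε‖ ≤ ‖g‖ := by
    intro ε hε
    have h1 := congrArg (inner ℝ (R ε g)) (hR1 ε hε g)
    rw [inner_add_right, inner_smul_right, real_inner_self_eq_norm_sq] at h1
    have h2 := hK (R ε g)
    have h3 := real_inner_le_norm (R ε g) g
    have h4 : ‖y ε‖ = ε * ‖R ε g‖ := by rw [hy, norm_smul, Real.norm_of_nonneg hε.le]
    rw [h4]
    rcases (norm_nonneg (R ε g)).eq_or_lt with h5 | h5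
    · rw [← h5]; simp
    · refine le_of_mul_le_mul_left ?_ h5
      nlinarith
  -- From `J u = K g` one gets `R ε (J u) = g - y ε`, and `R ε` commutes with `J` because `K` does.
  -- Writing `u = (K + ε) (R ε u)` then shows ⟨g - y ε, u⟩ ≥ 0.
  have hle : ∀ ε > 0, inner ℝ (y ε) u ≤ inner ℝ g u := by
    intro ε hε
    have h1 : R ε (J u) = g - y ε := by
      have h2 := hR2 ε hε g
      rw [map_add, map_smul] at h2
      rw [h, eq_sub_iff_add_eq]
      exact h2
    have h2 : R ε (J u) = J (R ε u) := by
      conv_lhs => rw [← hR1 ε hε u, map_add, map_smul, hJK, hR2 ε hε]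
    have h3 : 0 ≤ inner ℝ (J (R ε u)) u := by
      have h4 : inner ℝ (J (R ε u)) u = inner ℝ (J (R ε u)) (K (R ε u) + ε • R ε u) := by
        rw [hR1 ε hε u]
      rw [h4, inner_add_right, inner_smul_right]
      exact add_nonneg (hJK0 _) (mul_nonneg hε.le (hJ _))
    rw [← h2, h1, inner_sub_left] at h3
    linarith
  have hlim : ∀ δ > 0, -δ ≤ inner ℝ g u := by
    intro δ hδ
    -- The orthogonal complement of the range of `K*` is ker `K`, which is trivial.
    have hdense : u ∈ closure (LinearMap.range (K.adjoint : X →ₗ[ℝ] X) : Set X) := by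
      have : (LinearMap.range (K.adjoint : X →ₗ[ℝ] X)).topologicalClosure = ⊤ := by
        rw [Submodule.topologicalClosure_eq_top_iff, Submodule.eq_bot_iff]
        intro x hx
        refine hK0 x (ext_inner_left ℝ fun v => ?_)
        rw [inner_zero_right, ← ContinuousLinearMap.adjoint_inner_left]
        exact hx _ ⟨v, rfl⟩
      have hu : u ∈ (LinearMap.range (K.adjoint : X →ₗ[ℝ] X)).topologicalClosure :=
        this ▸ Submodule.mem_top
      exact hu
    obtain ⟨_, ⟨z, rfl⟩, hz⟩ := Metric.mem_closure_iff.1 hdense (δ / (2 * (‖g‖ + 1)))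
      (by positivity)
    -- Chosen so that ε · 2(‖g‖ + 1)(‖z‖ + 1) = δ/2, which bounds ⟨K (y ε), z⟩.
    set ε : ℝ := δ / (4 * (‖g‖ + 1) * (‖z‖ + 1)) with hεdef
    have hε : 0 < ε := by positivity
    refine le_trans ?_ (hle ε hε)
    have h1 : inner ℝ (y ε) u = inner ℝ (K (y ε)) z + inner ℝ (y ε) (u - K.adjoint z) := by
      rw [inner_sub_right, ContinuousLinearMap.adjoint_inner_right]
      ring
    have h2 : K (y ε) = ε • (g - y ε) := by
      rw [hy, map_smul, smul_sub, ← smul_sub]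
      congr 1
      rw [eq_sub_iff_add_eq]
      exact hR1 ε hε g
    have h3 : |inner ℝ (y ε) (u - K.adjoint z)| ≤ δ / 2 := by
      refine (abs_real_inner_le_norm _ _).trans ?_
      have hz' : ‖u - K.adjoint z‖ ≤ δ / (2 * (‖g‖ + 1)) := by
        rw [← dist_eq_norm]; exact hz.le
      calc _ ≤ (‖g‖ + 1) * (δ / (2 * (‖g‖ + 1))) := by
            gcongr
            linarith [hRn ε hε]
        _ = δ / 2 := by field_simp
    have h4 : |inner ℝ (K (y ε)) z| ≤ δ / 2 := by
      refine (abs_real_inner_le_norm _ _).trans ?_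
      rw [h2, norm_smul, Real.norm_of_nonneg hε.le]
      have : ‖g - y ε‖ ≤ 2 * (‖g‖ + 1) := (norm_sub_le _ _).trans (by linarith [hRn ε hε])
      calc _ ≤ ε * (2 * (‖g‖ + 1)) * (‖z‖ + 1) := by
            gcongr
            linarith
        _ = δ / 2 := by rw [hεdef]; field_simp; ring
    rw [h1]
    linarith [abs_le.1 h3, abs_le.1 h4]
  by_contra! hneg
  linarith [hlim (-inner ℝ g u / 2) (by linarith)]

/-- Well-posedness of `ι u + K A u = K f`, the integrated form of `ι u' + A u = f`, `u(0) = 0`. -/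
theorem exists_solution {J K A : X →L[ℝ] X} (hJK : ∀ x, J (K x) = K (J x))
    (hJsymm : ∀ x y, inner ℝ (J x) y = inner ℝ x (J y))
    (hJK0 : ∀ x, 0 ≤ inner ℝ (J x) (K x)) {c : ℝ} (hc : 0 < c)
    (hA : ∀ x, c * ‖x‖ ^ 2 ≤ inner ℝ (A x) x) (f : X) :
    ∃ u : X, J u + K (A u) = K f ∧ ‖u‖ ≤ c⁻¹ * ‖f‖ := by
  -- Pairing the equation with `x` and moving the operators onto `x` turns it into ⟨u, S x⟩ = ⟨f, K*
  -- x⟩ for all `x`.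
  set S : X →L[ℝ] X := J + A.adjoint ∘L K.adjoint with hS
  have hb : ∀ x, ‖K.adjoint x‖ ≤ c⁻¹ * ‖S x‖ := by
    intro x
    have h1 : inner ℝ (K.adjoint x) (S x) =
        inner ℝ (J x) (K x) + inner ℝ (A (K.adjoint x)) (K.adjoint x) := by
      rw [hS, add_apply, ContinuousLinearMap.comp_apply, inner_add_right,
        ContinuousLinearMap.adjoint_inner_right, ContinuousLinearMap.adjoint_inner_left, ← hJK,
        ← hJsymm]
    have h2 := hA (K.adjoint x)
    have h3 := real_inner_le_norm (K.adjoint x) (S x)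
    have h4 := hJK0 x
    rw [inv_mul_eq_div, le_div_iff₀ hc]
    rcases (norm_nonneg (K.adjoint x)).eq_or_lt with h5 | h5
    · rw [← h5]; simp
    · refine le_of_mul_le_mul_left ?_ h5
      nlinarith
  obtain ⟨u, hu, hu'⟩ := exists_inner_eq_of_norm_le (S : X →ₗ[ℝ] X)
    ((innerSL ℝ f ∘L K.adjoint : X →L[ℝ] ℝ) : X →ₗ[ℝ] ℝ) (c⁻¹ * ‖f‖) (by positivity) (fun x => by
      refine (abs_real_inner_le_norm f (K.adjoint x)).trans ?_
      calc _ ≤ ‖f‖ * (c⁻¹ * ‖S x‖) := by gcongr; exact hb x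
        _ = _ := by rw [ContinuousLinearMap.coe_coe]; ring)
  refine ⟨u, ext_inner_right ℝ fun v => ?_, hu⟩
  have h1 : inner ℝ u (S v) = inner ℝ f (K.adjoint v) := hu' v
  rw [hS, add_apply, ContinuousLinearMap.comp_apply, inner_add_right,
    ContinuousLinearMap.adjoint_inner_right, ContinuousLinearMap.adjoint_inner_right,
    ContinuousLinearMap.adjoint_inner_right, ← hJsymm] at h1
  rw [inner_add_left, h1]

/-- The difference `w` solves `J w = K(-A w)`, so monotonicity gives ⟨A w, w⟩ ≤ 0 and coercivity
forces `w = 0`. -/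
theorem solution_unique {J K A : X →L[ℝ] X} (hJK : ∀ x, J (K x) = K (J x))
    (hJ : ∀ x, 0 ≤ inner ℝ (J x) x) (hK : ∀ x, 0 ≤ inner ℝ x (K x))
    (hJK0 : ∀ x, 0 ≤ inner ℝ (J x) (K x)) (hK0 : ∀ x, K x = 0 → x = 0) {c : ℝ} (hc : 0 < c)
    (hA : ∀ x, c * ‖x‖ ^ 2 ≤ inner ℝ (A x) x) {f u v : X} (hu : J u + K (A u) = K f)
    (hv : J v + K (A v) = K f) : u = v := by
  have h1 : J (u - v) = K (-A (u - v)) := by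
    rw [map_neg, eq_neg_iff_add_eq_zero, map_sub, map_sub, map_sub, sub_add_sub_comm, hu, hv,
      sub_self]
  have h2 := inner_nonneg_of_eq_apply hJK hJ hK hJK0 hK0 h1
  rw [inner_neg_left] at h2
  have h3 := hA (u - v)
  have h4 : ‖u - v‖ ^ 2 ≤ 0 := by nlinarith [sq_nonneg ‖u - v‖]
  exact sub_eq_zero.1 (norm_eq_zero.1 (pow_eq_zero_iff two_ne_zero |>.1
    (le_antisymm h4 (sq_nonneg _))))

end Hilbert

/-! ### Weak time derivatives and primitives -/

section TimeDerivative

variable {T : ℝ} {X : Type} [NormedAddCommGroup X] [NormedSpace ℝ X]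

lemma IsTestFunction.integral_Iic_deriv {φ : ℝ → ℝ} (h : IsTestFunction (Ioo 0 T) φ) {t : ℝ}
    (ht : t ∈ Icc 0 T) : ∫ s in Iic t, deriv φ s ∂timeMeasure T = φ t := by
  have h0 : φ 0 = 0 := image_eq_zero_of_notMem_tsupport fun h0 => (h.2.2 h0).1.false
  have hset : Iic t ∩ Icc 0 T = Icc 0 t := by
    ext s
    simp only [mem_inter_iff, mem_Iic, mem_Icc]
    exact ⟨fun hs => ⟨hs.2.1, hs.1⟩, fun hs => ⟨hs.2, hs.1, hs.2.trans ht.2⟩⟩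
  rw [Measure.restrict_restrict measurableSet_Iic, hset, integral_Icc_eq_integral_Ioc,
    ← intervalIntegral.integral_of_le ht.1, intervalIntegral.integral_deriv_eq_sub
    (fun x _ => h.1.differentiable (by simp) x)
    ((h.1.continuous_deriv (by simp)).intervalIntegrable _ _), h0, sub_zero]

omit [NormedSpace ℝ X] in
lemma integrable_timeL2 (g : TimeL2 T X) : Integrable g (timeMeasure T) :=
  (Lp.memLp g).integrable one_le_two

lemma integral_Iic_zero (g : ℝ → X) : ∫ s in Iic 0, g s ∂timeMeasure T = 0 := by
  rw [Measure.restrict_restrict measurableSet_Iic]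
  refine setIntegral_measure_zero _ (measure_mono_null (t := {0}) (fun s hs => ?_) (by simp))
  exact le_antisymm hs.1 hs.2.1

/-- Integration by parts for the primitives of φ' and `g`; the boundary term vanishes since ∫ φ' =
φ(T) = 0. -/
lemma isWeakTimeDeriv_volterra [CompleteSpace X] (hT : 0 < T) (g : TimeL2 T X) :
    IsWeakTimeDeriv (volterra (timeMeasure T) g) g := by
  intro φ hφ
  have hT0 : φ T = 0 := image_eq_zero_of_notMem_tsupport fun h0 => (hφ.2.2 h0).2.false
  have hd : Integrable (deriv φ) (timeMeasure T) :=
    ((hφ.1.continuous_deriv (by simp)).integrable_of_hasCompactSupport hφ.2.1.deriv).restrict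
  have h := integral_bilin_primitive (ContinuousLinearMap.lsmul ℝ ℝ : ℝ →L[ℝ] X →L[ℝ] X) hd
    (integrable_timeL2 g)
  have h1 : ∫ s, deriv φ s ∂timeMeasure T = 0 := by
    rw [← hT0, ← hφ.integral_Iic_deriv (right_mem_Icc.2 hT.le),
      Measure.restrict_restrict measurableSet_Iic,
      inter_eq_right.2 fun x hx => hx.2]
  rw [h1, map_zero, zero_apply] at h
  rw [← add_eq_zero_iff_eq_neg, add_comm, ← h]
  congr 1
  · refine integral_congr_ae ?_
    filter_upwards [ae_restrict_mem measurableSet_Icc] with t ht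
    rw [hφ.integral_Iic_deriv ht]
    rfl
  · refine integral_congr_ae ?_
    filter_upwards [volterra_ae g] with t ht
    rw [ht]
    rfl

lemma ae_eq_zero_of_forall_isTestFunction [CompleteSpace X] {g : ℝ → X}
    (hg : Integrable g (timeMeasure T))
    (h : ∀ φ, IsTestFunction (Ioo 0 T) φ → ∫ t, φ t • g t ∂timeMeasure T = 0) :
    g =ᵐ[timeMeasure T] 0 := by
  have hg' : IntegrableOn g (Ioo 0 T) := hg.mono_measure
    (Measure.restrict_mono Ioo_subset_Icc_self le_rfl)
  have h1 := isOpen_Ioo.ae_eq_zero_of_integral_contDiff_smul_eq_zero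
    (μ := (volume : Measure ℝ)) (f := g) hg'.locallyIntegrableOn (fun φ h1 h2 h3 => by
      rw [← h φ ⟨h1, h2, h3⟩]
      refine (setIntegral_eq_integral_of_forall_compl_eq_zero fun t ht => ?_).symm
      rw [image_eq_zero_of_notMem_tsupport fun ht' => ht (Ioo_subset_Icc_self (h3 ht')),
        zero_smul])
  have h2 : ∀ᵐ t ∂volume.restrict (Ioo 0 T), g t = 0 :=
    (ae_restrict_iff' measurableSet_Ioo).2 h1
  rwa [restrict_Ioo_eq_restrict_Icc] at h2

/-- As the weak derivative of `K g = 0`, `g` is orthogonal to all test functions. This is the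
injectivity of `K` used for uniqueness. -/
lemma eq_zero_of_volterra_eq_zero [CompleteSpace X] (hT : 0 < T) (g : TimeL2 T X)
    (h : volterra (timeMeasure T) g = 0) : g = 0 := by
  refine (Lp.eq_zero_iff_ae_eq_zero).2
    (ae_eq_zero_of_forall_isTestFunction (integrable_timeL2 g) fun φ hφ => ?_)
  have h1 := isWeakTimeDeriv_volterra hT g φ hφ
  rw [h] at h1
  rw [← neg_eq_zero, ← h1]
  refine integral_eq_zero_of_ae ?_
  filter_upwards [Lp.coeFn_zero X 2 (timeMeasure T)] with t ht
  rw [ht, Pi.zero_apply, smul_zero]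

/-- A test function with vanishing integral is the derivative of a test function. -/
lemma IsTestFunction.exists_deriv_eq {η : ℝ → ℝ} (h : IsTestFunction (Ioo 0 T) η)
    (h0 : ∫ t, η t = 0) : ∃ φ, IsTestFunction (Ioo 0 T) φ ∧ deriv φ = η := by
  have hc : Continuous η := h.1.continuous
  have hd : ∀ t, HasDerivAt (fun t => ∫ s in (0 : ℝ)..t, η s) (η t) t := fun t =>
    intervalIntegral.integral_hasDerivAt_right (hc.intervalIntegrable _ _)
      (hc.stronglyMeasurableAtFilter _ _) hc.continuousAt
  have hderiv : deriv (fun t => ∫ s in (0 : ℝ)..t, η s) = η := funext fun t => (hd t).deriv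
  obtain ⟨a, b, ha, hb, hab⟩ : ∃ a b, 0 < a ∧ b < T ∧ tsupport η ⊆ Icc a b := by
    rcases (tsupport η).eq_empty_or_nonempty with he | hne
    -- For empty support any `a > 0` and `b < T` do; `Icc a b` may be empty, so `b < t < a` can
    -- occur below.
    · exact ⟨1, T - 1, one_pos, by linarith, by simp [he]⟩
    · obtain ⟨a, ha, ha'⟩ := h.2.1.exists_isLeast hne
      obtain ⟨b, hb, hb'⟩ := h.2.1.exists_isGreatest hne
      exact ⟨a, b, (h.2.2 ha).1, (h.2.2 hb).2, fun x hx => ⟨ha' hx, hb' hx⟩⟩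
  have hz : ∀ t, t ∉ Icc a b → η t = 0 := fun t ht =>
    image_eq_zero_of_notMem_tsupport fun ht' => ht (hab ht')
  have hleft : ∀ t, t < a → ∫ s in (0 : ℝ)..t, η s = 0 := by
    intro t ht
    refine intervalIntegral.integral_zero_ae (.of_forall fun s hs => hz s fun hs' => ?_)
    have := hs.2.trans_lt (max_lt ha ht)
    exact (hs'.1.trans_lt this).false
  have hright : ∀ t, b < t → ∫ s in (0 : ℝ)..t, η s = 0 := by
    intro t ht
    rcases lt_or_ge t a with hta | hta
    · exact hleft t hta
    rw [intervalIntegral.integral_of_le (ha.le.trans hta)]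
    refine Eq.trans ?_ h0
    refine setIntegral_eq_integral_of_forall_compl_eq_zero fun s hs => hz s fun hs' => hs ?_
    exact ⟨ha.trans_le hs'.1, hs'.2.trans ht.le⟩
  have hsupp : tsupport (fun t => ∫ s in (0 : ℝ)..t, η s) ⊆ Icc a b := by
    refine closure_minimal (fun t ht => ?_) isClosed_Icc
    by_contra hne
    rw [mem_Icc, not_and_or, not_le, not_le] at hne
    exact ht (hne.elim (hleft t) (hright t))
  refine ⟨_, ⟨contDiff_infty_iff_deriv.2 ⟨fun t => (hd t).differentiableAt, ?_⟩, ?_,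
    hsupp.trans fun t ht => ⟨ha.trans_le ht.1, ht.2.trans_lt hb⟩⟩, hderiv⟩
  · rw [hderiv]
    exact h.1
  · exact isCompact_Icc.of_isClosed_subset (isClosed_tsupport _) hsupp

lemma exists_isTestFunction_integral_eq_one (hT : 0 < T) :
    ∃ ρ : ℝ → ℝ, IsTestFunction (Ioo 0 T) ρ ∧ ∫ t, ρ t = 1 := by
  let b : ContDiffBump (T / 2) := ⟨T / 8, T / 4, by positivity, by linarith⟩
  refine ⟨b.normed volume, ⟨b.contDiff_normed, b.hasCompactSupport_normed, ?_⟩,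
    b.integral_normed⟩
  rw [b.tsupport_normed_eq, Real.closedBall_eq_Icc]
  intro t ht
  have h1 : T / 2 - T / 4 ≤ t := ht.1
  have h2 : t ≤ T / 2 + T / 4 := ht.2
  exact ⟨by linarith, by linarith⟩

/-- The lemma of du Bois-Reymond. -/
lemma exists_ae_eq_const [CompleteSpace X] (hT : 0 < T) {h : ℝ → X}
    (hh : Integrable h (timeMeasure T))
    (h0 : ∀ φ, IsTestFunction (Ioo 0 T) φ → ∫ t, deriv φ t • h t ∂timeMeasure T = 0) :
    ∃ c, h =ᵐ[timeMeasure T] fun _ => c := by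
  obtain ⟨ρ, hρ, hρ1⟩ := exists_isTestFunction_integral_eq_one hT
  have hint : ∀ ψ, IsTestFunction (Ioo 0 T) ψ → ∀ k : ℝ → X, Integrable k (timeMeasure T) →
      Integrable (fun t => ψ t • k t) (timeMeasure T) := by
    intro ψ hψ k hk
    obtain ⟨C, hC⟩ := hψ.1.continuous.bounded_above_of_compact_support hψ.2.1
    exact hk.bdd_smul C hψ.1.continuous.aestronglyMeasurable (.of_forall hC)
  have hfull : ∀ ψ, IsTestFunction (Ioo 0 T) ψ → ∫ t, ψ t ∂timeMeasure T = ∫ t, ψ t := by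
    intro ψ hψ
    refine setIntegral_eq_integral_of_forall_compl_eq_zero fun s hs => ?_
    exact image_eq_zero_of_notMem_tsupport fun hs' => hs (Ioo_subset_Icc_self (hψ.2.2 hs'))
  set c := ∫ t, ρ t • h t ∂timeMeasure T with hc
  refine ⟨c, ?_⟩
  have hconst : Integrable (fun _ : ℝ => c) (timeMeasure T) := integrable_const c
  have key : (fun t => h t - c) =ᵐ[timeMeasure T] 0 := by
    refine ae_eq_zero_of_forall_isTestFunction (hh.sub hconst) fun ψ hψ => ?_
    -- Subtracting `(∫ ψ) ρ` makes the integral zero, so the result is the derivative of a test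
    -- function; hence ∫ ψ h = (∫ ψ) c.
    have hη : IsTestFunction (Ioo 0 T) (fun t => ψ t - (∫ s, ψ s) * ρ t) := by
      refine ⟨hψ.1.sub (contDiff_const.mul hρ.1), ?_, ?_⟩
      · exact hψ.2.1.sub (hρ.2.1.mul_left (f := fun _ => ∫ s, ψ s))
      · refine (tsupport_sub _ _).trans (union_subset hψ.2.2 ?_)
        exact (tsupport_mul_subset_right (f := fun _ => ∫ s, ψ s)).trans hρ.2.2
    obtain ⟨φ, hφ, hφ'⟩ := hη.exists_deriv_eq (by
      rw [integral_sub (hψ.1.continuous.integrable_of_hasCompactSupport hψ.2.1)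
        ((hρ.1.continuous.integrable_of_hasCompactSupport hρ.2.1).const_mul _),
        integral_const_mul, hρ1, mul_one, sub_self])
    have h1 := h0 φ hφ
    simp only [hφ', sub_smul, mul_smul] at h1
    rw [integral_sub (hint ψ hψ h hh) ((hint ρ hρ h hh).fun_smul _), integral_smul] at h1
    simp only [smul_sub]
    rw [integral_sub (hint ψ hψ h hh) (hint ψ hψ _ hconst), integral_smul_const, hfull ψ hψ]
    exact h1
  filter_upwards [key] with t ht
  exact sub_eq_zero.1 ht

/-- The difference of `u` and the primitive of `g` has zero weak derivative, hence is constant;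
evaluating the continuous representative at 0 shows that the constant is 0. -/
lemma eq_volterra_of_isWeakTimeDeriv [CompleteSpace X] (hT : 0 < T) {u g : TimeL2 T X}
    (hug : IsWeakTimeDeriv u g) {w : ℝ → X} (hw : ContinuousOn w (Icc 0 T))
    (hwu : w =ᵐ[timeMeasure T] u) (hw0 : w 0 = 0) : u = volterra (timeMeasure T) g := by
  have hcont := continuous_integral_Iic (integrable_timeL2 g)
  obtain ⟨c, hc⟩ := exists_ae_eq_const hT (h := fun t => u t - volterra (timeMeasure T) g t)
    ((integrable_timeL2 u).sub (integrable_timeL2 _)) (fun φ hφ => by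
      have h1 := hφ.1.continuous_deriv (by simp)
      have h2 := hφ.2.1.deriv
      simp only [smul_sub]
      rw [integral_sub (integrable_smul_timeL2 h1 h2 _) (integrable_smul_timeL2 h1 h2 _),
        hug φ hφ, isWeakTimeDeriv_volterra hT g φ hφ, sub_self])
  -- Continuity upgrades equality almost everywhere to equality on all of `Icc 0 T`, which is what
  -- allows evaluation at the null set {0}.
  have heq : EqOn (fun t => w t - ∫ s in Iic t, g s ∂timeMeasure T) (fun _ => c) (Icc 0 T) := by
    refine Measure.eqOn_Icc_of_ae_eq volume hT.ne ?_ (hw.sub hcont.continuousOn)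
      continuousOn_const
    filter_upwards [hc, hwu, volterra_ae g] with t h1 h2 h3
    rw [h2, ← h3]
    exact h1
  have hc0 : c = 0 := by
    have h0 := heq (left_mem_Icc.2 hT.le)
    simp only [hw0, integral_Iic_zero, sub_zero] at h0
    exact h0.symm
  refine Lp.ext ?_
  filter_upwards [hc] with t ht
  rw [hc0] at ht
  exact sub_eq_zero.1 ht

end TimeDerivative

/-! ### Multiplication operators and pointwise operators -/

section Multiplication

variable {Y : Type*} [MeasurableSpace Y] {ν : Measure Y}

open Classical in
/-- Multiplication by a bounded function in `L_2`. -/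
def mulL2 (ν : Measure Y) (b : Y → ℝ) : Lp ℝ 2 ν →L[ℝ] Lp ℝ 2 ν :=
  -- The default 0 covers times outside (0,T], where nothing is assumed about the coefficients.
  if h : MemLp b ∞ ν then
    (ContinuousLinearMap.mul ℝ ℝ).holderL ν ∞ 2 2 h.toLp
  else 0

lemma mulL2_ae {b : Y → ℝ} (h : MemLp b ∞ ν) (f : Lp ℝ 2 ν) :
    mulL2 ν b f =ᵐ[ν] fun x => b x * f x := by
  rw [mulL2, dif_pos h, ContinuousLinearMap.holderL_apply_apply]
  filter_upwards [(ContinuousLinearMap.mul ℝ ℝ).coeFn_holder (r := 2) h.toLp f, h.coeFn_toLp]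
    with x h1 h2
  rw [h1, h2]
  rfl

lemma norm_mulL2_le {b : Y → ℝ} {M : ℝ} (hM : 0 ≤ M) (h : MemLp b ∞ ν)
    (hb : ∀ᵐ x ∂ν, |b x| ≤ M) : ‖mulL2 ν b‖ ≤ M := by
  refine ContinuousLinearMap.opNorm_le_bound _ hM fun f => ?_
  refine Lp.norm_le_mul_norm_of_ae_le_mul ?_
  filter_upwards [mulL2_ae h f, hb] with x h1 h2
  rw [h1, norm_mul]
  gcongr
  exact h2

lemma L2_norm_sq_eq_integral (f : Lp ℝ 2 ν) : ‖f‖ ^ 2 = ∫ x, f x ^ 2 ∂ν := by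
  rw [← real_inner_self_eq_norm_sq, L2.inner_def]
  refine integral_congr_ae (.of_forall fun x => ?_)
  change inner ℝ (f x) (f x) = _
  rw [real_inner_self_eq_norm_sq, Real.norm_eq_abs, sq_abs]

/-- Dominated convergence with majorant (2M)² f². Only strong continuity is claimed: continuity in
`t` is pointwise in `x`, not uniform. -/
lemma continuousOn_mulL2 {b : ℝ → Y → ℝ} {s : Set ℝ} {M : ℝ}
    (hmem : ∀ t ∈ s, MemLp (b t) ∞ ν) (hb : ∀ t ∈ s, ∀ᵐ x ∂ν, |b t x| ≤ M)
    (hcont : ∀ᵐ x ∂ν, ContinuousOn (fun t => b t x) s) (f : Lp ℝ 2 ν) :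
    ContinuousOn (fun t => mulL2 ν (b t) f) s := by
  intro t₀ ht₀
  have hsq : Filter.Tendsto (fun t => ∫ x, (b t x * f x - b t₀ x * f x) ^ 2 ∂ν)
      (nhdsWithin t₀ s) (nhds (∫ _, 0 ∂ν)) := by
    refine tendsto_integral_filter_of_dominated_convergence (fun x => (2 * M) ^ 2 * f x ^ 2)
      ?_ ?_ ((Lp.memLp f).integrable_sq.const_mul _) ?_
    · filter_upwards [self_mem_nhdsWithin] with t ht
      exact (((hmem t ht).1.mul (Lp.aestronglyMeasurable f)).sub
        ((hmem t₀ ht₀).1.mul (Lp.aestronglyMeasurable f))).pow 2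
    · filter_upwards [self_mem_nhdsWithin] with t ht
      filter_upwards [hb t ht, hb t₀ ht₀] with x h1 h2
      rw [← sub_mul, mul_pow, norm_mul, norm_pow, norm_pow, Real.norm_eq_abs, Real.norm_eq_abs,
        sq_abs (f x)]
      gcongr
      refine (abs_sub _ _).trans ?_
      linarith
    · filter_upwards [hcont] with x hx
      have h1 : Filter.Tendsto (fun t => b t x) (nhdsWithin t₀ s) (nhds (b t₀ x)) := hx t₀ ht₀
      have h2 := (((h1.mul_const (f x)).sub_const (b t₀ x * f x)).pow 2)
      simpa using h2
  rw [integral_zero] at hsq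
  rw [ContinuousWithinAt, tendsto_iff_norm_sub_tendsto_zero]
  have h1 := hsq.sqrt
  rw [Real.sqrt_zero] at h1
  refine h1.congr' ?_
  filter_upwards [self_mem_nhdsWithin] with t ht
  rw [← Real.sqrt_sq (norm_nonneg (mulL2 ν (b t) f - mulL2 ν (b t₀) f)), L2_norm_sq_eq_integral]
  congr 1
  refine integral_congr_ae ?_
  filter_upwards [Lp.coeFn_sub (mulL2 ν (b t) f) (mulL2 ν (b t₀) f), mulL2_ae (hmem t ht) f,
    mulL2_ae (hmem t₀ ht₀) f] with x h1 h2 h3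
  rw [h1, Pi.sub_apply, h2, h3]

end Multiplication

/-- A bounded, strongly continuous family of operators on `V` acts on `L_2(μ; V)`. -/
lemma exists_pointwise_operator {V : Type*} [NormedAddCommGroup V] [NormedSpace ℝ V]
    {μ : Measure ℝ} {s : Set ℝ} (hs : MeasurableSet s) (hμ : ∀ᵐ t ∂μ, t ∈ s)
    {Φ : ℝ → V →L[ℝ] V} {M : ℝ} (hM : ∀ t ∈ s, ‖Φ t‖ ≤ M)
    (hcont : ∀ v, ContinuousOn (fun t => Φ t v) s) :
    ∃ A : Lp V 2 μ →L[ℝ] Lp V 2 μ, ∀ u, A u =ᵐ[μ] fun t => Φ t (u t) := by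
  -- A uniform bound and strong continuity together give joint continuity in (t, v), hence
  -- measurability of t ↦ Φ t (u t).
  have hjoint : Continuous fun p : s × V => Φ p.1 p.2 := by
    have hM' : 0 ≤ max M 0 := le_max_right _ _
    refine continuous_iff_continuousAt.2 fun p => ?_
    rw [ContinuousAt, tendsto_iff_norm_sub_tendsto_zero]
    have h1 : Filter.Tendsto (fun q : s × V => max M 0 * ‖q.2 - p.2‖ + ‖Φ q.1 p.2 - Φ p.1 p.2‖)
        (nhds p) (nhds 0) := by
      have hc : Continuous fun q : s × V =>
          max M 0 * ‖q.2 - p.2‖ + ‖Φ q.1 p.2 - Φ p.1 p.2‖ := by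
        have h2 := (continuousOn_iff_continuous_domRestrict.1 (hcont p.2)).comp
          (continuous_fst : Continuous (Prod.fst : s × V → s))
        exact (continuous_const.mul (continuous_snd.sub continuous_const).norm).add
          (h2.sub continuous_const).norm
      simpa using hc.tendsto p
    refine squeeze_zero (fun _ => norm_nonneg _) (fun q => ?_) h1
    rw [← sub_add_sub_cancel _ (Φ q.1 p.2)]
    refine (norm_add_le _ _).trans ?_
    gcongr
    rw [← map_sub]
    exact ((Φ q.1).le_opNorm _).trans
      (by gcongr; exact (hM q.1 q.1.2).trans (le_max_left _ _))
  have hmeas : ∀ u : Lp V 2 μ, AEStronglyMeasurable (fun t => Φ t (u t)) μ := by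
    intro u
    have h1 : StronglyMeasurable fun t : s => Φ t (u t) :=
      hjoint.comp_stronglyMeasurable (stronglyMeasurable_id.prodMk
        ((Lp.stronglyMeasurable u).comp_measurable measurable_subtype_coe))
    have h2 : AEStronglyMeasurable (fun t => Φ t (u t)) (μ.restrict s) := by
      rw [← map_comap_subtype_coe hs,
        (MeasurableEmbedding.subtype_coe hs).aestronglyMeasurable_map_iff]
      exact h1.aestronglyMeasurable
    rwa [Measure.restrict_eq_self_of_ae_mem hμ] at h2
  have hle : ∀ u : Lp V 2 μ, ∀ᵐ t ∂μ, ‖Φ t (u t)‖ ≤ M * ‖u t‖ := by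
    intro u
    filter_upwards [hμ] with t ht
    exact ((Φ t).le_opNorm _).trans (by gcongr; exact hM t ht)
  have hmem : ∀ u : Lp V 2 μ, MemLp (fun t => Φ t (u t)) 2 μ := fun u =>
    (Lp.memLp u).of_le_mul (hmeas u) (hle u)
  refine ⟨LinearMap.mkContinuous
    { toFun u := (hmem u).toLp
      map_add' u v := ?_
      map_smul' c u := ?_ } M fun u => ?_, fun u => (hmem u).coeFn_toLp⟩
  · rw [← MemLp.toLp_add]
    refine MemLp.toLp_congr _ _ ?_
    filter_upwards [Lp.coeFn_add u v] with t ht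
    rw [ht, Pi.add_apply, map_add, Pi.add_apply]
  · rw [← MemLp.toLp_const_smul]
    refine MemLp.toLp_congr _ _ ?_
    filter_upwards [Lp.coeFn_smul c u] with t ht
    rw [ht, Pi.smul_apply, map_smul, Pi.smul_apply, RingHom.id_apply]
  · refine Lp.norm_le_mul_norm_of_ae_le_mul ?_
    filter_upwards [(hmem u).coeFn_toLp, hle u] with t h1 h2
    change ‖(hmem u).toLp _ t‖ ≤ _
    rw [h1]
    exact h2

/-! ### Completeness of the Sobolev spaces -/

/-- Each defining identity equates two continuous functionals, since pairing with a test function is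
an L₂ inner product. Completeness of `H0 m D` follows, as needed for adjoints and the Riesz
isomorphism. -/
lemma isClosed_Hm {d : ℕ} (m : ℕ) (D : Set (Space d)) :
    IsClosed (Hm m D : Set (PiLp 2 (fun _ : MultiIndex d m => L2 D))) := by
  have hcont : ∀ (φ : Space d → ℝ), IsTestFunction D φ → ∀ α : MultiIndex d m,
      Continuous fun u : PiLp 2 (fun _ : MultiIndex d m => L2 D) => ∫ x in D, u α x * φ x := by
    intro φ hφ α
    have hmem : MemLp φ 2 (volume.restrict D) :=
      hφ.1.continuous.memLp_of_hasCompactSupport hφ.2.1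
    have h1 : ∀ g : L2 D, ∫ x in D, g x * φ x = inner ℝ hmem.toLp g := by
      intro g
      rw [L2.inner_def]
      refine integral_congr_ae ?_
      filter_upwards [hmem.coeFn_toLp] with x hx
      rw [hx]
      rfl
    simp_rw [h1]
    exact continuous_const.inner (PiLp.continuous_apply 2 _ α)
  have hset : (Hm m D : Set (PiLp 2 (fun _ : MultiIndex d m => L2 D))) =
      ⋂ (α : MultiIndex d m) (φ : Space d → ℝ) (_ : IsTestFunction D φ),
        {u | ∫ x in D, u (MultiIndex.zero d m) x * multiDeriv α φ x =
          (-1 : ℝ) ^ α.length * ∫ x in D, u α x * φ x} := by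
    ext u
    simp only [mem_iInter]
    rfl
  rw [hset]
  refine isClosed_iInter fun α => isClosed_iInter fun φ => isClosed_iInter fun hφ => ?_
  exact isClosed_eq (hcont _ (hφ.multiDeriv α) _) (continuous_const.mul (hcont φ hφ α))

instance {d : ℕ} (m : ℕ) (D : Set (Space d)) : CompleteSpace (H0 m D) :=
  haveI : CompleteSpace (Hm m D) := (isClosed_Hm m D).completeSpace_coe
  (testFunctions m D).isClosed_topologicalClosure.completeSpace_coe

/-! ### The operator of the bilinear form -/

section FormOperator

variable {d m : ℕ} {D : Set (Space d)} {T : ℝ} {a : Coefficients d m}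

/-- The operator `A(t)` on `H^m_0(D)` with `(A(t) u, v) = B(t, u, v)`. -/
def formOperator (D : Set (Space d)) (a : Coefficients d m) (t : ℝ) : H0 m D →L[ℝ] H0 m D :=
  ∑ α : MultiIndex d m, ∑ β : MultiIndex d m, (-1 : ℝ) ^ (m + α.length) •
    ((weakD α : H0 m D →L[ℝ] L2 D).adjoint ∘L
      mulL2 (volume.restrict D) (a α β t) ∘L weakD β)

lemma IsAdmissible.memLp (ha : IsAdmissible D T a) (hD : IsOpen D) (α β : MultiIndex d m)
    {t : ℝ} (ht : t ∈ Ioc 0 T) : MemLp (a α β t) ∞ (volume.restrict D) := by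
  obtain ⟨M, hM⟩ := ha.bounded
  have hc : ContinuousOn (a α β t) D := (ha.smooth α β).continuousOn.comp
    (f := fun x => (t, x)) (by fun_prop) fun x hx => ⟨ht, hx⟩
  refine memLp_top_of_bound (hc.aestronglyMeasurable hD.measurableSet) M ?_
  filter_upwards [ae_restrict_mem hD.measurableSet] with x hx
  exact hM α β t ht x hx

lemma IsAdmissible.inner_formOperator (ha : IsAdmissible D T a) (hD : IsOpen D) {t : ℝ}
    (ht : t ∈ Ioc 0 T) (u v : H0 m D) :
    inner ℝ (formOperator D a t u) v = bilinearForm a t u v := by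
  simp only [formOperator, sum_apply, sum_inner, smul_apply, real_inner_smul_left,
    ContinuousLinearMap.comp_apply, ContinuousLinearMap.adjoint_inner_left, bilinearForm]
  refine Finset.sum_congr rfl fun α _ => Finset.sum_congr rfl fun β _ => ?_
  rw [L2.inner_def]
  congr 1
  refine integral_congr_ae ?_
  filter_upwards [mulL2_ae (ha.memLp hD α β ht) (weakD β u)] with x hx
  rw [hx, real_inner_comm]
  rfl

lemma IsAdmissible.exists_norm_formOperator_le (ha : IsAdmissible D T a) (hD : IsOpen D) :
    ∃ M, ∀ t ∈ Ioc 0 T, ‖formOperator D a t‖ ≤ M := by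
  obtain ⟨M, hM⟩ := ha.bounded
  refine ⟨∑ α : MultiIndex d m, ∑ β : MultiIndex d m,
    ‖(weakD α : H0 m D →L[ℝ] L2 D).adjoint‖ * (max M 0 * ‖(weakD β : H0 m D →L[ℝ] L2 D)‖),
    fun t ht => ?_⟩
  refine (norm_sum_le _ _).trans (Finset.sum_le_sum fun α _ => ?_)
  refine (norm_sum_le _ _).trans (Finset.sum_le_sum fun β _ => ?_)
  rw [norm_smul, norm_pow, norm_neg, norm_one, one_pow, one_mul]
  refine (ContinuousLinearMap.opNorm_comp_le _ _).trans ?_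
  gcongr
  refine (ContinuousLinearMap.opNorm_comp_le _ _).trans ?_
  gcongr
  refine norm_mulL2_le (le_max_right _ _) (ha.memLp hD α β ht) ?_
  filter_upwards [ae_restrict_mem hD.measurableSet] with x hx
  exact (hM α β t ht x hx).trans (le_max_left _ _)

lemma IsAdmissible.continuousOn_formOperator (ha : IsAdmissible D T a) (hD : IsOpen D)
    (u : H0 m D) : ContinuousOn (fun t => formOperator D a t u) (Ioc 0 T) := by
  obtain ⟨M, hM⟩ := ha.bounded
  simp only [formOperator, sum_apply, smul_apply, ContinuousLinearMap.comp_apply]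
  refine continuousOn_finsetSum _ fun α _ => continuousOn_finsetSum _ fun β _ => ?_
  have hmul : ContinuousOn (fun t => mulL2 (volume.restrict D) (a α β t) (weakD β u))
      (Ioc 0 T) := by
    refine continuousOn_mulL2 (M := M) (fun t ht => ha.memLp hD α β ht) (fun t ht => ?_) ?_ _
    · filter_upwards [ae_restrict_mem hD.measurableSet] with x hx
      exact hM α β t ht x hx
    · filter_upwards [ae_restrict_mem hD.measurableSet] with x hx
      exact (ha.smooth α β).continuousOn.comp (f := fun t => (t, x)) (by fun_prop)
        fun t ht => ⟨ht, hx⟩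
  exact (((weakD α : H0 m D →L[ℝ] L2 D).adjoint.continuous).comp_continuousOn hmul).const_smul
    ((-1 : ℝ) ^ (m + α.length))

end FormOperator

/-! ### The parabolic equation as an operator equation -/

section Parabolic

/-- The Riesz isomorphism of a real Hilbert space onto its dual. -/
def riesz (V : Type*) [NormedAddCommGroup V] [InnerProductSpace ℝ V] [CompleteSpace V] :
    V ≃ₗᵢ[ℝ] StrongDual ℝ V :=
  InnerProductSpace.toDual ℝ V

lemma riesz_apply {V : Type*} [NormedAddCommGroup V] [InnerProductSpace ℝ V] [CompleteSpace V]
    (u v : V) : riesz V u v = inner ℝ u v := rfl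

/-- The operator `P* P`, which represents `toDualVia P`. -/
def gram {V H : Type*} [NormedAddCommGroup V] [InnerProductSpace ℝ V] [CompleteSpace V]
    [NormedAddCommGroup H] [InnerProductSpace ℝ H] [CompleteSpace H] (P : V →L[ℝ] H) :
    V →L[ℝ] V := P.adjoint ∘L P

lemma riesz_gram {V H : Type*} [NormedAddCommGroup V] [InnerProductSpace ℝ V] [CompleteSpace V]
    [NormedAddCommGroup H] [InnerProductSpace ℝ H] [CompleteSpace H] (P : V →L[ℝ] H) (u : V) :
    riesz V (gram P u) = toDualVia P u := by
  ext v
  rw [riesz_apply, toDualVia_apply, gram, ContinuousLinearMap.comp_apply,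
    ContinuousLinearMap.adjoint_inner_left]

/-- Source of the symmetry and positivity of `J`, and of the reduction of ⟨J x, K x⟩ to ⟨P x, K P
x⟩. -/
lemma inner_gram_compLp {V H : Type*} [NormedAddCommGroup V] [InnerProductSpace ℝ V]
    [CompleteSpace V] [NormedAddCommGroup H] [InnerProductSpace ℝ H] [CompleteSpace H]
    {μ : Measure ℝ} (P : V →L[ℝ] H) (u v : Lp V 2 μ) :
    inner ℝ ((gram P).compLp u) v = inner ℝ (P.compLp u) (P.compLp v) := by
  rw [L2.inner_def, L2.inner_def]
  refine integral_congr_ae ?_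
  filter_upwards [(gram P).coeFn_compLp u, P.coeFn_compLp u, P.coeFn_compLp v] with t h1 h2 h3
  rw [h1, h2, h3, gram, ContinuousLinearMap.comp_apply, ContinuousLinearMap.adjoint_inner_left]

lemma compLp_compLp {E F G : Type*} [NormedAddCommGroup E] [NormedSpace ℝ E]
    [NormedAddCommGroup F] [NormedSpace ℝ F] [NormedAddCommGroup G] [NormedSpace ℝ G]
    {μ : Measure ℝ} (Q : F →L[ℝ] G) (P : E →L[ℝ] F) (u : Lp E 2 μ) :
    Q.compLp (P.compLp u) = (Q ∘L P).compLp u := by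
  refine Lp.ext ?_
  filter_upwards [Q.coeFn_compLp (P.compLp u), P.coeFn_compLp u, (Q ∘L P).coeFn_compLp u]
    with t h1 h2 h3
  rw [h1, h2, h3]
  rfl

variable {d m : ℕ} {D : Set (Space d)} {T : ℝ} {a : Coefficients d m}

/-- The coefficients are controlled only for t > 0; the endpoint 0 is a null set. -/
lemma ae_mem_Ioc : ∀ᵐ t ∂timeMeasure T, t ∈ Ioc 0 T := by
  rw [timeMeasure, ← restrict_Ioc_eq_restrict_Icc]
  exact ae_restrict_mem measurableSet_Ioc

/-- The Riesz isomorphism of `H^m_0(D)`, as a bounded operator. -/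
def rieszCLM (m : ℕ) (D : Set (Space d)) : H0 m D →L[ℝ] Hneg m D :=
  ((riesz (H0 m D)).toContinuousLinearEquiv : H0 m D →L[ℝ] Hneg m D)

/-- The inverse Riesz isomorphism of `H^m_0(D)`, as a bounded operator. -/
def rieszSymmCLM (m : ℕ) (D : Set (Space d)) : Hneg m D →L[ℝ] H0 m D :=
  ((riesz (H0 m D)).symm.toContinuousLinearEquiv : Hneg m D →L[ℝ] H0 m D)

lemma rieszCLM_rieszSymmCLM : rieszCLM m D ∘L rieszSymmCLM m D = .id ℝ _ :=
  ContinuousLinearMap.ext fun f => (riesz (H0 m D)).apply_symm_apply f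

lemma rieszSymmCLM_rieszCLM : rieszSymmCLM m D ∘L rieszCLM m D = .id ℝ _ :=
  ContinuousLinearMap.ext fun f => (riesz (H0 m D)).symm_apply_apply f

lemma compLp_id {E : Type*} [NormedAddCommGroup E] [NormedSpace ℝ E] {μ : Measure ℝ}
    (u : Lp E 2 μ) : (ContinuousLinearMap.id ℝ E).compLp u = u :=
  Lp.ext ((ContinuousLinearMap.id ℝ E).coeFn_compLp u)

lemma embed_eq : embed m D =
    rieszCLM m D ∘L gram (weakD (MultiIndex.zero d m) : H0 m D →L[ℝ] L2 D) :=
  ContinuousLinearMap.ext fun u => (riesz_gram _ u).symm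

lemma norm_rieszCLM_compLp_le (u : TimeL2 T (H0 m D)) : ‖(rieszCLM m D).compLp u‖ ≤ ‖u‖ := by
  refine Lp.norm_le_norm_of_ae_le ?_
  filter_upwards [(rieszCLM m D).coeFn_compLp u] with t ht
  rw [ht]
  exact ((riesz (H0 m D)).norm_map _).le

lemma norm_rieszSymmCLM_compLp_le (f : TimeL2 T (Hneg m D)) :
    ‖(rieszSymmCLM m D).compLp f‖ ≤ ‖f‖ := by
  refine Lp.norm_le_norm_of_ae_le ?_
  filter_upwards [(rieszSymmCLM m D).coeFn_compLp f] with t ht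
  rw [ht]
  exact ((riesz (H0 m D)).symm.norm_map _).le

/-- The time derivative of a weak solution is `f - A u`. -/
lemma IsAdmissible.equation_iff (ha : IsAdmissible D T a) (hD : IsOpen D)
    {A : TimeL2 T (H0 m D) →L[ℝ] TimeL2 T (H0 m D)}
    (hA : ∀ u, A u =ᵐ[timeMeasure T] fun t => formOperator D a t (u t))
    (u : TimeL2 T (H0 m D)) (f g : TimeL2 T (Hneg m D)) :
    (∀ᵐ t ∂timeMeasure T, ∀ v : H0 m D, g t v + bilinearForm a t (u t) v = f t v) ↔
      g = f - (rieszCLM m D).compLp (A u) := by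
  have key : ∀ᵐ t ∂timeMeasure T, (f - (rieszCLM m D).compLp (A u)) t =
      f t - rieszCLM m D (formOperator D a t (u t)) := by
    filter_upwards [Lp.coeFn_sub f ((rieszCLM m D).compLp (A u)),
      (rieszCLM m D).coeFn_compLp (A u), hA u] with t h1 h2 h3
    rw [h1, Pi.sub_apply, h2, h3]
  have hform : ∀ t ∈ Ioc 0 T, ∀ v : H0 m D,
      rieszCLM m D (formOperator D a t (u t)) v = bilinearForm a t (u t) v :=
    fun t ht v => ha.inner_formOperator hD ht (u t) v
  constructor
  · intro h
    refine Lp.ext ?_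
    filter_upwards [h, key, ae_mem_Ioc] with t h1 h2 ht
    rw [h2]
    ext v
    rw [sub_apply, hform t ht, ← h1 v, add_sub_cancel_right]
  · rintro rfl
    filter_upwards [key, ae_mem_Ioc] with t h2 ht v
    rw [h2, sub_apply, hform t ht, sub_add_cancel]

lemma IsCoercive.inner_le (hcoer : IsCoercive D T a) (ha : IsAdmissible D T a) (hD : IsOpen D)
    {A : TimeL2 T (H0 m D) →L[ℝ] TimeL2 T (H0 m D)}
    (hA : ∀ u, A u =ᵐ[timeMeasure T] fun t => formOperator D a t (u t)) :
    ∃ c : ℝ, 0 < c ∧ ∀ u, c * ‖u‖ ^ 2 ≤ inner ℝ (A u) u := by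
  obtain ⟨c, hc, h⟩ := hcoer
  refine ⟨c, hc, fun u => ?_⟩
  rw [← real_inner_self_eq_norm_sq, L2.inner_def, L2.inner_def, ← integral_const_mul]
  refine integral_mono_ae ((L2.integrable_inner u u).const_mul c) (L2.integrable_inner _ _) ?_
  filter_upwards [h, hA u, ae_mem_Ioc] with t h1 h2 ht
  rw [h2, ha.inner_formOperator hD ht]
  change c * inner ℝ (u t) (u t) ≤ _
  rw [real_inner_self_eq_norm_sq]
  exact h1 (u t)

/-- The initial condition in integrated form. -/
lemma vanishesAtZero_iff (hT : 0 < T) (u : ParabolicSpace m D T) :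
    ParabolicSpace.VanishesAtZero u ↔ (embed m D).compLp (ParabolicSpace.val u) =
      volterra (timeMeasure T) (ParabolicSpace.timeDeriv u) := by
  have hu : (embed m D).compLp (ParabolicSpace.val u) = u.1.snd.1.fst := u.2
  have hwd : IsWeakTimeDeriv ((embed m D).compLp (ParabolicSpace.val u))
      (ParabolicSpace.timeDeriv u) := hu ▸ u.1.snd.2
  have hae := (embed m D).coeFn_compLp (ParabolicSpace.val u)
  constructor
  · rintro ⟨w, hw, hwu, hw0⟩
    refine eq_volterra_of_isWeakTimeDeriv hT hwd hw ?_ hw0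
    filter_upwards [hwu, hae] with t h1 h2
    rw [h1, h2]
  · intro h
    -- The continuous representative is the primitive of the time derivative itself.
    refine ⟨_, (continuous_integral_Iic
      (integrable_timeL2 (ParabolicSpace.timeDeriv u))).continuousOn, ?_, integral_Iic_zero _⟩
    filter_upwards [hae, volterra_ae (ParabolicSpace.timeDeriv u)] with t h1 h2
    rw [← h1, h, h2]

/-- The Riesz isomorphism is injective and commutes with the Volterra operator, so the integrated
equation can be pulled back from `H^{-m}(D)` to `H^m_0(D)`. -/
lemma embed_compLp_eq_volterra_iff (x y : TimeL2 T (H0 m D)) (f : TimeL2 T (Hneg m D)) :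
    (embed m D).compLp x = volterra (timeMeasure T) (f - (rieszCLM m D).compLp y) ↔
      (gram (weakD (MultiIndex.zero d m) : H0 m D →L[ℝ] L2 D)).compLp x +
        volterra (timeMeasure T) y = volterra (timeMeasure T) ((rieszSymmCLM m D).compLp f) := by
  have hinj : Function.Injective fun g : TimeL2 T (H0 m D) => (rieszCLM m D).compLp g :=
    Function.LeftInverse.injective (g := fun g => (rieszSymmCLM m D).compLp g) fun g => by
      simp only
      rw [compLp_compLp, rieszSymmCLM_rieszCLM, compLp_id]
  have h1 : f - (rieszCLM m D).compLp y =
      (rieszCLM m D).compLp ((rieszSymmCLM m D).compLp f - y) := by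
    change _ = (rieszCLM m D).compLpL 2 (timeMeasure T) _
    rw [map_sub]
    change _ = (rieszCLM m D).compLp ((rieszSymmCLM m D).compLp f) - _
    rw [compLp_compLp, rieszCLM_rieszSymmCLM, compLp_id]
    rfl
  rw [h1, volterra_compLp, embed_eq, ← compLp_compLp, hinj.eq_iff, map_sub, eq_sub_iff_add_eq]

/-- A weak solution is a solution of the integrated equation. -/
lemma IsAdmissible.isWeakSolution_iff (ha : IsAdmissible D T a) (hD : IsOpen D) (hT : 0 < T)
    {A : TimeL2 T (H0 m D) →L[ℝ] TimeL2 T (H0 m D)}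
    (hA : ∀ u, A u =ᵐ[timeMeasure T] fun t => formOperator D a t (u t))
    (f : TimeL2 T (Hneg m D)) (u : ParabolicSpace m D T) :
    IsWeakSolution a f u ↔
      ParabolicSpace.timeDeriv u = f - (rieszCLM m D).compLp (A (ParabolicSpace.val u)) ∧
      (gram (weakD (MultiIndex.zero d m) : H0 m D →L[ℝ] L2 D)).compLp (ParabolicSpace.val u) +
        volterra (timeMeasure T) (A (ParabolicSpace.val u)) =
          volterra (timeMeasure T) ((rieszSymmCLM m D).compLp f) := by
  rw [IsWeakSolution, ha.equation_iff hD hA, vanishesAtZero_iff hT]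
  refine and_congr_right fun h => ?_
  rw [h, embed_compLp_eq_volterra_iff]

lemma ParabolicSpace.ext_val_timeDeriv {u v : ParabolicSpace m D T}
    (h1 : ParabolicSpace.val u = ParabolicSpace.val v)
    (h2 : ParabolicSpace.timeDeriv u = ParabolicSpace.timeDeriv v) : u = v := by
  have hu : (embed m D).compLp (ParabolicSpace.val u) = u.1.snd.1.fst := u.2
  have hv : (embed m D).compLp (ParabolicSpace.val v) = v.1.snd.1.fst := v.2
  refine Subtype.ext (WithLp.ofLp_injective _ (Prod.ext h1 (Subtype.ext
    (WithLp.ofLp_injective _ (Prod.ext ?_ h2)))))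
  change u.1.snd.1.fst = v.1.snd.1.fst
  rw [← hu, ← hv, h1]

lemma ParabolicSpace.norm_le (u : ParabolicSpace m D T) :
    ‖u‖ ≤ (1 + ‖embed m D‖) * ‖ParabolicSpace.val u‖ + ‖ParabolicSpace.timeDeriv u‖ := by
  have hu : (embed m D).compLp (ParabolicSpace.val u) = u.1.snd.1.fst := u.2
  have h1 : ‖u‖ = ‖u.1.fst‖ + ‖u.1.snd‖ := WithLp.prod_norm_eq_of_L1 u.1
  have h2 : ‖u.1.snd‖ ≤ ‖u.1.snd.1.fst‖ + ‖u.1.snd.1.snd‖ := by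
    change ‖u.1.snd.1‖ ≤ _
    rw [WithLp.prod_norm_eq_of_L2]
    refine Real.sqrt_le_iff.2 ⟨by positivity, ?_⟩
    nlinarith [norm_nonneg u.1.snd.1.fst, norm_nonneg u.1.snd.1.snd]
  have h3 : ‖u.1.snd.1.fst‖ ≤ ‖embed m D‖ * ‖ParabolicSpace.val u‖ :=
    hu ▸ (embed m D).norm_compLp_le _
  rw [h1]
  change ‖ParabolicSpace.val u‖ + _ ≤ _
  change _ ≤ _ + ‖u.1.snd.1.snd‖
  linarith

/-- The integrated equation already supplies the time regularity: a primitive has its integrand as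
weak derivative. -/
lemma exists_parabolicSpace (hT : 0 < T) {x : TimeL2 T (H0 m D)} {g : TimeL2 T (Hneg m D)}
    (h : (embed m D).compLp x = volterra (timeMeasure T) g) :
    ∃ u : ParabolicSpace m D T, ParabolicSpace.val u = x ∧ ParabolicSpace.timeDeriv u = g :=
  ⟨⟨WithLp.toLp 1 (x, ⟨WithLp.toLp 2 ((embed m D).compLp x, g), by
    change IsWeakTimeDeriv ((embed m D).compLp x) g
    exact h ▸ isWeakTimeDeriv_volterra hT g⟩), rfl⟩, rfl, rfl⟩

end Parabolic

end ParabolicSobolev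

end

/-! ### Well-posedness of the parabolic problem -/

theorem mainTheorem8 {d m : ℕ} (hm : 1 ≤ m)
    (D : Set (ParabolicSobolev.Space d)) (hDopen : IsOpen D) (hDbdd : Bornology.IsBounded D)
    (T : ℝ) (hT : 0 < T) (a : ParabolicSobolev.Coefficients d m)
    (ha : ParabolicSobolev.IsAdmissible D T a) (hcoer : ParabolicSobolev.IsCoercive D T a) :
    ∃ C : ℝ, ∀ f : ParabolicSobolev.TimeL2 T (ParabolicSobolev.Hneg m D),
      ∃ u : ParabolicSobolev.ParabolicSpace m D T,
        ParabolicSobolev.IsWeakSolution a f u ∧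
        (∀ v : ParabolicSobolev.ParabolicSpace m D T,
          ParabolicSobolev.IsWeakSolution a f v → v = u) ∧
        ‖u‖ ≤ C * ‖f‖ := by
  open ParabolicSobolev in
  obtain ⟨M, hM⟩ := ha.exists_norm_formOperator_le hDopen
  obtain ⟨A, hA⟩ := exists_pointwise_operator (μ := timeMeasure T) measurableSet_Ioc ae_mem_Ioc hM
    (ha.continuousOn_formOperator hDopen)
  obtain ⟨c, hc, hAc⟩ := hcoer.inner_le ha hDopen hA
  let P : H0 m D →L[ℝ] L2 D := weakD (MultiIndex.zero d m)
  let J : TimeL2 T (H0 m D) →L[ℝ] TimeL2 T (H0 m D) := (gram P).compLpL 2 (timeMeasure T)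
  let K : TimeL2 T (H0 m D) →L[ℝ] TimeL2 T (H0 m D) := volterra (timeMeasure T)
  have hJK : ∀ x, J (K x) = K (J x) := fun x => (volterra_compLp (gram P) x).symm
  have hJsymm : ∀ x y, inner ℝ (J x) y = inner ℝ x (J y) := fun x y =>
    (inner_gram_compLp P x y).trans
      ((real_inner_comm _ _).trans ((inner_gram_compLp P y x).symm.trans (real_inner_comm _ _)))
  have hJ : ∀ x, 0 ≤ inner ℝ (J x) x := fun x =>
    real_inner_self_nonneg.trans_eq (inner_gram_compLp P x x).symm
  have hJK0 : ∀ x, 0 ≤ inner ℝ (J x) (K x) := fun x => by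
    refine le_of_le_of_eq ?_ (inner_gram_compLp P x (K x)).symm
    rw [← volterra_compLp P x]
    exact inner_volterra_nonneg _
  -- The first summand comes from ‖x‖ ≤ c⁻¹‖f‖ and counts `x` with its image in `H^{-m}(D)`; the
  -- second bounds ∂ₜu = f - A x.
  refine ⟨(1 + ‖embed m D‖) * c⁻¹ + (1 + ‖A‖ * c⁻¹), fun f => ?_⟩
  obtain ⟨x, hx, hxn⟩ := exists_solution hJK hJsymm hJK0 hc hAc ((rieszSymmCLM m D).compLp f)
  obtain ⟨u, hu, hu'⟩ := exists_parabolicSpace hT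
    ((embed_compLp_eq_volterra_iff x (A x) f).2 hx)
  have hxf : ‖x‖ ≤ c⁻¹ * ‖f‖ :=
    hxn.trans (by gcongr; exact norm_rieszSymmCLM_compLp_le f)
  refine ⟨u, (ha.isWeakSolution_iff hDopen hT hA f u).2 ⟨by rw [hu', hu], by rw [hu]; exact hx⟩,
    fun v hv => ?_, ?_⟩
  · obtain ⟨h1, h2⟩ := (ha.isWeakSolution_iff hDopen hT hA f v).1 hv
    have h3 : ParabolicSpace.val v = x := solution_unique hJK hJ
      (fun x => inner_volterra_nonneg x) hJK0 (eq_zero_of_volterra_eq_zero hT) hc hAc h2 hx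
    exact ParabolicSpace.ext_val_timeDeriv (h3.trans hu.symm) (by rw [h1, h3, hu'])
  · have hd : ‖ParabolicSpace.timeDeriv u‖ ≤ ‖f‖ + ‖A‖ * (c⁻¹ * ‖f‖) := by
      rw [hu']
      refine (norm_sub_le _ _).trans ?_
      gcongr
      exact (norm_rieszCLM_compLp_le _).trans ((A.le_opNorm x).trans (by gcongr))
    calc ‖u‖ ≤ (1 + ‖embed m D‖) * (c⁻¹ * ‖f‖) + (‖f‖ + ‖A‖ * (c⁻¹ * ‖f‖)) := by
          refine (ParabolicSpace.norm_le u).trans ?_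
          rw [hu]
          gcongr
      _ = _ := by ring
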